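/- Let $p$ be a prime, let $(R,\mathfrak m)$ be an excellent regular local ring of characteristic $p$, and let $I \subsetneq R$ be an ideal of height at least two such that $R/I$ is F-pure (that is, the Frobenius map $F\colon R/I \to R/I$ is a pure ring homomorphism). For $m \ge 0$ let $I^{(m)}$ be the $m$-th symbolic power of $I$, i.e. the contraction of $I^m R_W$ to $R$, where $W$ is the complement in $R$ of the union of the associated primes of $I$. Let $\widehat R$ be the $\mathfrak m$-adic completion of $R$, and let $I^{(\bullet)}\widehat R = \{I^{(m)}\widehat R\}_{m\ge 0}$ be the extension to $\widehat R$ of the family $I^{(\bullet)}=\{I^{(m)}\}_{m\ge 0}$. For a Noetherian ring $S$ of characteristic $p$ and a family of ideals $\mathfrak a_\bullet=\{\mathfrak a_m\}_{m \ge 0}$ of $S$, the generalized test ideal is $$\tau(S,\mathfrak a_\bullet)=\bigcap_M \operatorname{Ann}_S\bigl(0_M^{*\mathfrak a_\bullet}\bigr),$$ where $M$ runs through all finitely generated $S$-modules and $0_M^{*\mathfrak a_\bullet}$ is the set of all $z\in M$ for which there is an element $c\in S$ lying in no minimal prime of $S$ such that $c\,\mathfrak a_{q}\,(z\otimes 1)=0$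 in $M\otimes_S {}^e\!S$ for all large $q=p^e$; here ${}^e\!S$ denotes $S$ regarded as an $S$-module via $F^e$, and $S$ acts on $M\otimes_S{}^e\!S$ by multiplication on the factor ${}^e\!S$. Then $\tau\bigl(\widehat R, I^{(\bullet)}\widehat R\bigr)=\widehat R$. Moreover, if $R$ is F-finite (that is, $R$ is a finitely generated module over itself via Frobenius), then also $\tau\bigl(R, I^{(\bullet)}\bigr)=R$. -/

import Mathlib

open scoped TensorProduct

universe u

noncomputable section

/-! ### Excellent rings -/

/-- A commutative ring is catenary if for any two primes the lengths of the chains of primes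
between them are bounded, and all maximal (that is, saturated) such chains have the same length. -/
def IsCatenaryRing (S : Type u) [CommRing S] : Prop :=
  ∀ P Q : PrimeSpectrum S,
    (∃ n : ℕ, ∀ l : LTSeries (PrimeSpectrum S), l.head = P → l.last = Q → l.length ≤ n) ∧
    ∀ l l' : LTSeries (PrimeSpectrum S),
      (∀ i : Fin l.length, l.toFun i.castSucc ⋖ l.toFun i.succ) →
      (∀ i : Fin l'.length, l'.toFun i.castSucc ⋖ l'.toFun i.succ) →
      l.head = P → l.last = Q → l'.head = P → l'.last = Q → l.length = l'.length

/-- An algebra over a field `k` is geometrically regular if it stays a regular ring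
after every finite extension of `k`. -/
def IsGeometricallyRegular (k : Type u) [Field k] (A : Type u) [CommRing A] [Algebra k A] : Prop :=
  ∀ (L : Type u) [Field L] [Algebra k L] [FiniteDimensional k L], IsRegularRing (L ⊗[k] A)

/-- A local ring has geometrically regular formal fibres if all fibres of the map to its
completion are geometrically regular over the corresponding residue fields. -/
def HasGeometricallyRegularFormalFibres (A : Type u) [CommRing A] [IsLocalRing A] : Prop :=
  ∀ (q : Ideal A) [q.IsPrime],
    IsGeometricallyRegular q.ResidueField
      (q.Fiber (AdicCompletion (IsLocalRing.maximalIdeal A) A))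

/-- An excellent ring: a Noetherian ring that is universally catenary, is a G-ring (all of its
local rings have geometrically regular formal fibres), and is J-2 (every algebra of finite type
over it has open regular locus). -/
structure IsExcellentRing (R : Type u) [CommRing R] : Prop where
  noetherian : IsNoetherianRing R
  universally_catenary : ∀ (S : Type u) [CommRing S] [Algebra R S] [Algebra.FiniteType R S],
    IsCatenaryRing S
  g_ring : ∀ (P : Ideal R) [P.IsPrime],
    HasGeometricallyRegularFormalFibres (Localization.AtPrime P)
  j_two : ∀ (S : Type u) [CommRing S] [Algebra R S] [Algebra.FiniteType R S],
    IsOpen {P : PrimeSpectrum S | IsRegularLocalRing (Localization.AtPrime P.asIdeal)}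

/-! ### The Frobenius functor, F-purity and F-finiteness -/

/-- The ring `ᵉR`: a copy of `R`, viewed as an `R`-algebra through the `e`-times iterated
Frobenius map `x ↦ x ^ (p ^ e)` (for reduced `R` this is `R → R^{1/p^e}`). -/
def FrobeniusCopy (R : Type u) (_p _e : ℕ) : Type u := R

namespace FrobeniusCopy

variable (R : Type u) [CommRing R] (p e : ℕ)

instance : CommRing (FrobeniusCopy R p e) := inferInstanceAs (CommRing R)

/-- The identity map, as a ring isomorphism from `R` to its copy. -/
def equiv : R ≃+* FrobeniusCopy R p e := RingEquiv.refl R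

instance [ExpChar R p] : Algebra R (FrobeniusCopy R p e) :=
  ((equiv R p e).toRingHom.comp (iterateFrobenius R p e)).toAlgebra

theorem algebraMap_apply [ExpChar R p] (r : R) :
    algebraMap R (FrobeniusCopy R p e) r = equiv R p e (r ^ p ^ e) := rfl

end FrobeniusCopy

/-- The Frobenius functor `𝔽ᵉ(M) = ᵉR ⊗_R M`. The elements of `R` act on it through the
factor `ᵉR` by multiplication. -/
abbrev FrobeniusPullback (R : Type u) [CommRing R] (p e : ℕ) [ExpChar R p]
    (M : Type u) [AddCommGroup M] [Module R M] : Type u :=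
  FrobeniusCopy R p e ⊗[R] M

/-- The element `z^q = F_M^e(z) = 1 ⊗ z` of `𝔽ᵉ(M)`, where `q = p ^ e`. -/
def frobeniusElement (R : Type u) [CommRing R] (p e : ℕ) [ExpChar R p]
    {M : Type u} [AddCommGroup M] [Module R M] (z : M) : FrobeniusPullback R p e M :=
  (1 : FrobeniusCopy R p e) ⊗ₜ[R] z

/-- `N_M^{[q]}`, the image of `𝔽ᵉ(N) → 𝔽ᵉ(M)`, where `q = p ^ e`. -/
def frobeniusSubmodule (R : Type u) [CommRing R] (p e : ℕ) [ExpChar R p]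
    {M : Type u} [AddCommGroup M] [Module R M] (N : Submodule R M) :
    Submodule (FrobeniusCopy R p e) (FrobeniusPullback R p e M) :=
  LinearMap.range (N.subtype.baseChange (FrobeniusCopy R p e))

/-- An `R`-algebra `S` is pure if `M → S ⊗_R M` is injective for every `R`-module `M`. -/
def IsPureAlgebra (R S : Type u) [CommRing R] [CommRing S] [Algebra R S] : Prop :=
  ∀ (M : Type u) [AddCommGroup M] [Module R M],
    Function.Injective (fun z : M => (1 : S) ⊗ₜ[R] z)

/-- A ring is F-pure (for the prime `p`) if it has characteristic `p` and its Frobenius map is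
pure. A pure ring map is injective, so that such a ring is reduced. -/
def IsFPure (p : ℕ) [Fact p.Prime] (R : Type u) [CommRing R] : Prop :=
  ∃ _ : CharP R p, IsPureAlgebra R (FrobeniusCopy R p 1)

/-- A ring of characteristic `p` is F-finite if it is a finitely generated module over itself
through the Frobenius map. -/
def IsFFinite (p : ℕ) [Fact p.Prime] (R : Type u) [CommRing R] [CharP R p] : Prop :=
  Module.Finite R (FrobeniusCopy R p 1)

/-! ### Tight closure and test ideals of families of ideals -/

/-- `R°`, the multiplicative set of elements of `R` that lie in no minimal prime ideal. -/
def minimalPrimesCompl (R : Type u) [CommRing R] : Submonoid R where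
  carrier := {c | ∀ P ∈ minimalPrimes R, c ∉ P}
  one_mem' := fun P hP h => hP.1.1.ne_top ((Ideal.eq_top_iff_one P).2 h)
  mul_mem' := fun ha hb P hP h => (hP.1.1.mem_or_mem h).elim (ha P hP) (hb P hP)

/-- The `𝔞_•^k`-tight closure `N_M^{*𝔞_•^k}` of `N` in `M`: all `z ∈ M` for which there is
`c ∈ R°` such that `c 𝔞_{kq} z^q ⊆ N_M^{[q]}` for all large `q = p ^ e`. -/
def tightClosure {R : Type u} [CommRing R] (p : ℕ) [Fact p.Prime] [CharP R p]
    (𝔞 : ℕ → Ideal R) (k : ℕ) {M : Type u} [AddCommGroup M] [Module R M]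
    (N : Submodule R M) : Submodule R M where
  carrier := {z | ∃ c ∈ minimalPrimesCompl R, ∃ e₀ : ℕ, ∀ e ≥ e₀, ∀ a ∈ 𝔞 (k * p ^ e),
    FrobeniusCopy.equiv R p e (c * a) • frobeniusElement R p e z ∈ frobeniusSubmodule R p e N}
  zero_mem' := ⟨1, Submonoid.one_mem _, 0, fun e _ a _ => by
    simp [frobeniusElement]⟩
  add_mem' := by
    rintro z w ⟨c, hc, e₁, h₁⟩ ⟨d, hd, e₂, h₂⟩
    refine ⟨c * d, Submonoid.mul_mem _ hc hd, max e₁ e₂, fun e he a ha => ?_⟩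
    have hz := Submodule.smul_mem _ (FrobeniusCopy.equiv R p e d)
      (h₁ e (le_trans (le_max_left _ _) he) a ha)
    have hw := Submodule.smul_mem _ (FrobeniusCopy.equiv R p e c)
      (h₂ e (le_trans (le_max_right _ _) he) a ha)
    rw [smul_smul, ← map_mul] at hz hw
    have : frobeniusElement R p e (z + w)
        = frobeniusElement R p e z + frobeniusElement R p e w := by
      simp [frobeniusElement, TensorProduct.tmul_add]
    rw [this, smul_add]
    refine Submodule.add_mem _ ?_ ?_
    · rwa [show c * d * a = d * (c * a) by ring]
    · rwa [show c * d * a = c * (d * a) by ring]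
  smul_mem' := by
    rintro r z ⟨c, hc, e₀, h⟩
    refine ⟨c, hc, e₀, fun e he a ha => ?_⟩
    have : frobeniusElement R p e (r • z)
        = FrobeniusCopy.equiv R p e (r ^ p ^ e) • frobeniusElement R p e z := by
      rw [← FrobeniusCopy.algebraMap_apply, algebraMap_smul]
      simp [frobeniusElement]
    rw [this, smul_comm]
    exact Submodule.smul_mem _ _ (h e he a ha)

/-- The generalized test ideal `τ(𝔞_•^k) = ⋂_M Ann_R (0_M^{*𝔞_•^k})`, where `M` runs through all
finitely generated `R`-modules. -/
def generalizedTestIdeal {R : Type u} [CommRing R] (p : ℕ) [Fact p.Prime] [CharP R p]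
    (𝔞 : ℕ → Ideal R) (k : ℕ) : Ideal R :=
  ⨅ (M : Type u) (_ : AddCommGroup M) (_ : Module R M) (_ : Module.Finite R M),
    (tightClosure p 𝔞 k (⊥ : Submodule R M)).annihilator

/-! ### Symbolic powers -/

/-- The complement of the union of the associated primes of `I` (that is, of `R ⧸ I`). -/
def associatedPrimesCompl {R : Type u} [CommRing R] (I : Ideal R) : Submonoid R where
  carrier := {s | ∀ P ∈ associatedPrimes R (R ⧸ I), s ∉ P}
  one_mem' := fun P hP h => hP.1.ne_top ((Ideal.eq_top_iff_one P).2 h)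
  mul_mem' := fun ha hb P hP h => (hP.1.mem_or_mem h).elim (ha P hP) (hb P hP)

/-- The symbolic power `I^{(m)}`: the contraction of `I^m R_W` to `R`, where `W` is the complement
of the union of the associated primes of `I`. -/
def symbolicPower {R : Type u} [CommRing R] (I : Ideal R) (m : ℕ) : Ideal R :=
  ((I ^ m).map (algebraMap R (Localization (associatedPrimesCompl I)))).comap
    (algebraMap R (Localization (associatedPrimesCompl I)))

/-! ### The completion of a local ring -/

/-- The completion of a Noetherian local ring of prime characteristic `p` has
characteristic `p`. -/
instance charP_adicCompletion (R : Type u) [CommRing R] [IsLocalRing R] [IsNoetherianRing R]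
    (p : ℕ) [Fact p.Prime] [CharP R p] :
    CharP (AdicCompletion (IsLocalRing.maximalIdeal R) R) p := by
  refine (CharP.charP_iff_prime_eq_zero (Fact.out : p.Prime)).2 ?_
  rw [← map_natCast (algebraMap R (AdicCompletion (IsLocalRing.maximalIdeal R) R)),
    CharP.cast_eq_zero, map_zero]

end

/-!
Let `(R, 𝔪)` be a regular local ring of characteristic `p`, and write `J^{[q]}` for the Frobenius
power of an ideal `J`. Both equalities come from a single element `u` of the symbolic power `I^{(p)}`
that lies outside `𝔪^{[p]}`.

*Why such a `u` suffices.* If `u ∈ I^{(p)}`, then `u ^ q ∈ I^{(pq)}` for all `q = p ^ e`. If `z ≠ 0`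
lay in the tight closure of zero, some `c ≠ 0` would satisfy `c u ^ q ∈ 𝔪^{[pq]}` for all large `q`;
flatness of Frobenius turns this into `c ∈ (𝔪^{[p]} : u)^{[q]} ⊆ 𝔪^{[q]}`, and Krull's intersection
theorem gives `c = 0`. This is `generalizedTestIdeal_eq_top`; it needs only a Noetherian local ring
whose maximal ideal is generated by a regular sequence. It therefore applies to the completion too,
which is Noetherian (`isNoetherianRing_of_isAdicComplete`) and faithfully flat over `R`, so that
regular sequences and `u ∉ 𝔪^{[p]}` are inherited.

*Why `u` exists.* By Fedder's criterion (`IsFPure.exists_mul_mem_frobeniusPower`), F-purity of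
`R ⧸ I` yields `u ∈ I^{[p]} : I` outside `𝔪^{[p]}`. Moreover `I^{[p]} : I ⊆ I^{(p)}`
(`mem_symbolicPower_of_mul_mem_frobeniusPower`): the ideal `I` is radical, so after localization at
an associated prime it becomes the maximal ideal `𝔫` of a regular local ring of dimension at least
two, and there `𝔫^{[p]} : 𝔫 ⊆ 𝔫 ^ p`: modulo `𝔫^{[p]}` the colon is generated by
`(y₁ ⋯ y_h) ^ (p - 1)` for regular parameters `y₁, …, y_h`, and `h (p - 1) ≥ p` as `h ≥ 2`. The localizations of `R` are regular since the regular locus of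
an excellent ring is open.

Fedder's criterion is proved by Gorenstein duality, with no condition on the residue field. For a parameter
ideal `J = (x₁ ^ t, …, x_d ^ t)` with socle generator `s` and `L = J : I`, purity tested on `L ⧸ J`
says `s ^ p ∉ J^{[p]} + I L^{[p]}`. A multiplier that detects this modulo `J^{[p]}`
(`HasSimpleSocle.exists_mul_notMem`) lies in `(J + I)^{[p]} : I` but not in `𝔪^{[p]}`, and the
Artin–Rees lemma lets `t` tend to infinity.

Flatness of Frobenius is used only for modules of finite length, where it follows from the case of
the residue field (`lTensor_injective_of_isFiniteLength`, `mem_frobeniusPower_of_smul_eq_zero`).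
-/

/-! ### Permutable regular sequences and the socle of a parameter ideal -/

section RegularSequences

open RingTheory.Sequence IsLocalRing

theorem isWeaklyRegular_concat_iff {S : Type*} [CommRing S] {M : Type*} [AddCommGroup M]
    [Module S M] (l : List S) (x : S) :
    IsWeaklyRegular M (l ++ [x]) ↔ IsWeaklyRegular M l ∧
      ∀ m : M, x • m ∈ (Ideal.ofList l • ⊤ : Submodule S M) →
        m ∈ (Ideal.ofList l • ⊤ : Submodule S M) := by
  rw [isWeaklyRegular_append_iff, isWeaklyRegular_singleton_iff]
  refine and_congr_right fun _ => ?_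
  rw [isSMulRegular_iff_right_eq_zero_of_smul]
  constructor
  · intro h m hm
    rw [← Submodule.Quotient.mk_eq_zero] at hm ⊢
    exact h _ (by rwa [← Submodule.Quotient.mk_smul])
  · intro h m
    obtain ⟨m, rfl⟩ := Submodule.Quotient.mk_surjective _ m
    rw [← Submodule.Quotient.mk_smul, Submodule.Quotient.mk_eq_zero, Submodule.Quotient.mk_eq_zero]
    exact h m

theorem Ideal.ofList_perm {S : Type*} [CommSemiring S] {l l' : List S} (h : l.Perm l') :
    Ideal.ofList l = Ideal.ofList l' :=
  congrArg Ideal.span (Set.ext fun _ => h.mem_iff)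

/-- A permutation-invariant property of lists that survives raising one entry to the `n`-th power
survives raising all entries to the `n`-th power. -/
theorem List.map_pow_induction {R : Type*} [Monoid R] {Q : List R → Prop} {n : ℕ}
    (perm : ∀ l l', l.Perm l' → Q l → Q l') (head : ∀ x l, Q (x :: l) → Q (x ^ n :: l))
    (l : List R) (h : Q l) : Q (l.map (· ^ n)) := by
  suffices H : ∀ l l' : List R, Q (l ++ l') → Q (l.map (· ^ n) ++ l') by
    simpa using H l [] (by simpa using h)
  intro l
  induction l with
  | nil => exact fun _ h => h
  | cons x l ih =>
    intro l' h
    refine perm (l.map (· ^ n) ++ x ^ n :: l') _ List.perm_middle (ih _ ?_)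
    exact perm _ _ List.perm_middle.symm (head x _ h)

variable {R : Type*} [CommRing R] [IsLocalRing R]

/-- The socle of `R ⧸ J` is a one-dimensional vector space over the residue field: it is generated
by the class of an element `s ∉ J`. -/
def HasSimpleSocle (J : Ideal R) : Prop :=
  ∃ s, s ∉ J ∧ (∀ a ∈ maximalIdeal R, a * s ∈ J) ∧
    ∀ f, (∀ a ∈ maximalIdeal R, a * f ∈ J) → f ∈ J ⊔ Ideal.span {s}

theorem hasSimpleSocle_maximalIdeal : HasSimpleSocle (maximalIdeal R) := by
  refine ⟨1, fun h => ?_, fun a ha => by simpa using ha, fun f _ => ?_⟩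
  · exact (Ideal.ne_top_iff_one _).1 (maximalIdeal.isMaximal R).ne_top h
  · simp

theorem mem_maximalIdeal_of_isRegular {l : List R} (h : IsRegular R l) :
    ∀ x ∈ l, x ∈ maximalIdeal R := by
  intro x hx
  refine le_maximalIdeal (fun ht => h.2 ?_) (Ideal.subset_span hx : x ∈ Ideal.ofList l)
  rw [show Ideal.ofList l = ⊤ from ht, Submodule.top_smul]

variable [IsNoetherianRing R]

/-- Regular sequences in Noetherian local rings are permutable, so that the first entry may be tested
last. -/
theorem isRegular_cons_iff_colon {x : R} {l : List R} (hx : x ∈ maximalIdeal R) :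
    IsRegular R (x :: l) ↔ IsRegular R l ∧ ∀ f, x * f ∈ Ideal.ofList l → f ∈ Ideal.ofList l := by
  have key : (∀ f, x * f ∈ Ideal.ofList l → f ∈ Ideal.ofList l) ↔
      ∀ m : R, x • m ∈ (Ideal.ofList l • ⊤ : Submodule R R) →
        m ∈ (Ideal.ofList l • ⊤ : Submodule R R) := by
    simp
  constructor
  · intro h
    have h' : IsRegular R (l ++ [x]) :=
      isRegular_of_perm h (List.perm_append_singleton x l).symm
    have h1 := (isWeaklyRegular_concat_iff l x).1 h'.1
    refine ⟨.of_isWeaklyRegular_of_mem_maximalIdeal R (fun r hr => ?_) h1.1, key.2 h1.2⟩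
    exact mem_maximalIdeal_of_isRegular h r (List.mem_cons_of_mem _ hr)
  · rintro ⟨h1, h2⟩
    refine isRegular_of_perm (.of_isWeaklyRegular_of_mem_maximalIdeal R (fun r hr => ?_)
      ((isWeaklyRegular_concat_iff l x).2 ⟨h1.1, key.1 h2⟩)) (List.perm_append_singleton x l)
    rcases List.mem_append.1 hr with hr | hr
    · exact mem_maximalIdeal_of_isRegular h1 r hr
    · rwa [List.mem_singleton.1 hr]

theorem isRegular_pow_cons {x : R} {l : List R} (h : IsRegular R (x :: l)) {n : ℕ} (hn : 0 < n) :
    IsRegular R (x ^ n :: l) := by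
  have hx := mem_maximalIdeal_of_isRegular h x List.mem_cons_self
  obtain ⟨h1, h2⟩ := (isRegular_cons_iff_colon hx).1 h
  refine (isRegular_cons_iff_colon (Ideal.pow_mem_of_mem _ hx n hn)).2 ⟨h1, ?_⟩
  clear hn
  induction n with
  | zero => simp
  | succ n ih => exact fun f hf => ih f (h2 _ (by rwa [← mul_assoc, ← pow_succ']))

theorem isRegular_map_pow {l : List R} (h : IsRegular R l) {n : ℕ} (hn : 0 < n) :
    IsRegular R (l.map (· ^ n)) :=
  List.map_pow_induction (fun _ _ hp h => isRegular_of_perm h hp)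
    (fun _ _ h => isRegular_pow_cons h hn) l h

/-- If `x` is regular modulo `J' = (l)`, multiplication by `x ^ (n - 1)` identifies the socle of
`R ⧸ (x, J')` with that of `R ⧸ (x ^ n, J')`. -/
theorem hasSimpleSocle_pow_cons {x : R} {l : List R} (h : IsRegular R (x :: l))
    (hs : HasSimpleSocle (Ideal.ofList (x :: l))) {n : ℕ} (hn : 0 < n) :
    HasSimpleSocle (Ideal.ofList (x ^ n :: l)) := by
  obtain ⟨n, rfl⟩ : ∃ k, n = k + 1 := ⟨n - 1, by omega⟩
  clear hn
  have hx := mem_maximalIdeal_of_isRegular h x List.mem_cons_self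
  have hcol : ∀ k f, x ^ k * f ∈ Ideal.ofList l → f ∈ Ideal.ofList l := by
    intro k
    induction k with
    | zero => simp
    | succ n ih =>
      exact fun f hf => ih f (((isRegular_cons_iff_colon hx).1 h).2 _
        (by rwa [← mul_assoc, ← pow_succ']))
  obtain ⟨s, hs1, hs2, hs3⟩ := hs
  -- membership in `(x ^ k) + (l)`, spelled out
  have hm : ∀ k f, f ∈ Ideal.ofList (x ^ k :: l) ↔ ∃ a, f - a * x ^ k ∈ Ideal.ofList l := by
    intro k f
    rw [Ideal.ofList_cons, Ideal.mem_span_singleton_sup]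
    constructor
    · rintro ⟨a, b, hb, rfl⟩
      exact ⟨a, by simpa using hb⟩
    · rintro ⟨a, ha⟩
      exact ⟨a, _, ha, by ring⟩
  have hm1 : ∀ f, f ∈ Ideal.ofList (x :: l) ↔ ∃ a, f - a * x ∈ Ideal.ofList l := by
    simpa using hm 1
  have shift : ∀ f, x ^ n * f ∈ Ideal.ofList (x ^ (n + 1) :: l) ↔ f ∈ Ideal.ofList (x :: l) := by
    intro f
    rw [hm, hm1]
    refine exists_congr fun a => ⟨fun h => hcol n _ ?_, fun h => ?_⟩
    · convert h using 1; ring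
    · convert Ideal.mul_mem_left _ (x ^ n) h using 1; ring
  refine ⟨x ^ n * s, ?_, fun a ha => ?_, fun f hf => ?_⟩
  · rwa [shift]
  · rw [mul_left_comm, shift]
    exact hs2 a ha
  · obtain ⟨g, hg⟩ := (hm _ _).1 (hf x hx)
    have hfg : f - x ^ n * g ∈ Ideal.ofList l := by
      refine hcol 1 _ ?_
      convert hg using 1; ring
    have hsub : Ideal.ofList l ≤ Ideal.ofList (x ^ (n + 1) :: l) := by
      rw [Ideal.ofList_cons]; exact le_sup_right
    have hgs : g ∈ Ideal.ofList (x :: l) ⊔ Ideal.span {s} := by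
      refine hs3 g fun a ha => (shift _).1 ?_
      have := Ideal.sub_mem _ (hf a ha) (Ideal.mul_mem_left _ a (hsub hfg))
      convert this using 1; ring
    obtain ⟨j, hj, t, ht, rfl⟩ := Submodule.mem_sup.1 hgs
    obtain ⟨b, rfl⟩ := Ideal.mem_span_singleton'.1 ht
    have h1 : f = (f - x ^ n * (j + b * s) + x ^ n * j) + b * (x ^ n * s) := by ring
    rw [h1]
    exact Submodule.add_mem_sup (Ideal.add_mem _ (hsub hfg) ((shift j).2 hj))
      (Ideal.mem_span_singleton'.2 ⟨b, rfl⟩)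

theorem hasSimpleSocle_map_pow {l : List R} (h : IsRegular R l)
    (hl : Ideal.ofList l = maximalIdeal R) {n : ℕ} (hn : 0 < n) :
    HasSimpleSocle (Ideal.ofList (l.map (· ^ n))) := by
  refine (List.map_pow_induction (n := n)
    (Q := fun l => IsRegular R l ∧ HasSimpleSocle (Ideal.ofList l)) ?_ ?_ l ⟨h, ?_⟩).2
  · exact fun _ _ hp h => ⟨isRegular_of_perm h.1 hp, Ideal.ofList_perm hp ▸ h.2⟩
  · exact fun _ _ h => ⟨isRegular_pow_cons h.1 hn, hasSimpleSocle_pow_cons h.1 h.2 hn⟩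
  · rw [hl]; exact hasSimpleSocle_maximalIdeal

end RegularSequences

/-! ### Double annihilators over Artinian local rings with simple socle -/

section Duality

open IsLocalRing

variable {A : Type u} [CommRing A] [IsLocalRing A]

theorem length_eq_ker_add_range {R M P : Type*} [Ring R] [AddCommGroup M] [Module R M]
    [AddCommGroup P] [Module R P] (f : M →ₗ[R] P) :
    Module.length R M = Module.length R (LinearMap.ker f) + Module.length R (LinearMap.range f) :=
  Module.length_eq_add_of_exact (LinearMap.ker f).subtype f.rangeRestrict
    (Submodule.subtype_injective _) f.surjective_rangeRestrict fun x => by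
      rw [← LinearMap.mem_ker, LinearMap.ker_rangeRestrict]
      exact ⟨fun h => ⟨⟨x, h⟩, rfl⟩, by rintro ⟨y, rfl⟩; exact y.2⟩

/-- Over a local ring whose socle is generated by one element, dualizing into the ring does not
increase the length of a module. -/
theorem length_dual_le {s : A} (hs : ∀ f : A, (∀ a ∈ maximalIdeal A, a * f = 0) →
    f ∈ Ideal.span {s}) (hs' : ∀ a ∈ maximalIdeal A, a * s = 0)
    {M : Type u} [AddCommGroup M] [Module A M] (hM : IsFiniteLength A M) :
    Module.length A (M →ₗ[A] A) ≤ Module.length A M := by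
  induction hM with
  | @of_subsingleton M _ _ _ =>
    have : Subsingleton (M →ₗ[A] A) := ⟨fun f g => LinearMap.ext fun x => by
      rw [Subsingleton.elim x 0, map_zero, map_zero]⟩
    simp
  | @of_simple_quotient M _ _ N hsimple _ ih =>
    let f : (M ⧸ N →ₗ[A] A) →ₗ[A] (M →ₗ[A] A) := LinearMap.lcomp A A N.mkQ
    let g : (M →ₗ[A] A) →ₗ[A] (N →ₗ[A] A) := LinearMap.lcomp A A N.subtype
    have hker : LinearMap.ker g ≤ LinearMap.range f := by
      intro φ h
      have h' : ∀ x ∈ N, φ x = 0 := fun x hx => LinearMap.congr_fun h (⟨x, hx⟩ : N)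
      exact ⟨N.liftQ φ h', N.liftQ_mkQ φ h'⟩
    have hfr : Module.length A (LinearMap.range f) ≤ Module.length A (M ⧸ N →ₗ[A] A) := by
      refine Module.length_le_of_surjective (LinearMap.rangeRestrict f) ?_
      exact LinearMap.surjective_rangeRestrict f
    rw [length_eq_ker_add_range g,
      Module.length_eq_add_of_exact N.subtype N.mkQ N.subtype_injective N.mkQ_surjective
        (LinearMap.exact_subtype_mkQ N), add_comm]
    refine add_le_add ((Module.length_le_of_injective _ (Submodule.subtype_injective _)).trans ih)
      ((Module.length_le_of_injective _ (Submodule.inclusion_injective hker)).trans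
      (hfr.trans ?_))
    rw [Module.length_eq_one_iff.2 hsimple]
    -- a homomorphism from the residue field is determined by a socle element
    obtain ⟨I, hI, ⟨e⟩⟩ := isSimpleModule_iff_quot_maximal.1 hsimple
    obtain rfl := eq_maximalIdeal hI
    let z : M ⧸ N := e.symm (Submodule.Quotient.mk 1)
    have hz : ∀ x : M ⧸ N, ∃ a : A, x = a • z := by
      intro x
      obtain ⟨a, ha⟩ := Submodule.Quotient.mk_surjective _ (e x)
      refine ⟨a, e.injective ?_⟩
      rw [map_smul, e.apply_symm_apply, ← ha, ← Submodule.Quotient.mk_smul, smul_eq_mul, mul_one]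
    have hz' : ∀ a ∈ maximalIdeal A, a • z = 0 := by
      intro a ha
      apply e.injective
      rw [map_smul, e.apply_symm_apply, ← Submodule.Quotient.mk_smul, map_zero,
        Submodule.Quotient.mk_eq_zero, smul_eq_mul, mul_one]
      exact ha
    let ev : (M ⧸ N →ₗ[A] A) →ₗ[A] A := LinearMap.applyₗ z
    have hev : ∀ φ, ev φ ∈ Ideal.span {s} := fun φ => hs _ fun a ha => by
      change a * φ z = 0
      rw [← smul_eq_mul, ← map_smul, hz' a ha, map_zero]
    have hinj : Function.Injective (ev.codRestrict _ hev) := by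
      intro φ ψ h
      refine LinearMap.ext fun x => ?_
      obtain ⟨a, rfl⟩ := hz x
      have : φ z = ψ z := congrArg Subtype.val h
      rw [map_smul, map_smul, this]
    refine (Module.length_le_of_injective _ hinj).trans ?_
    let t : A ⧸ maximalIdeal A →ₗ[A] (Ideal.span {s} : Ideal A) :=
      (maximalIdeal A).liftQ
        (LinearMap.toSpanSingleton A _ ⟨s, Ideal.mem_span_singleton_self s⟩)
        (fun a ha => Subtype.ext (hs' a ha))
    have ht : Function.Surjective t := by
      rintro ⟨x, hx⟩
      obtain ⟨a, rfl⟩ := Ideal.mem_span_singleton'.1 hx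
      exact ⟨Submodule.Quotient.mk a, rfl⟩
    refine (Module.length_le_of_surjective t ht).trans ?_
    have : IsSimpleModule A (A ⧸ maximalIdeal A) :=
      isSimpleModule_iff_quot_maximal.2 ⟨_, maximalIdeal.isMaximal A, ⟨LinearEquiv.refl _ _⟩⟩
    rw [Module.length_eq_one]

/-- In an Artinian local ring with simple socle every ideal is its own double annihilator. -/
theorem annihilator_annihilator_le (hA : IsFiniteLength A A) {s : A}
    (hs : ∀ f : A, (∀ a ∈ maximalIdeal A, a * f = 0) → f ∈ Ideal.span {s})
    (hs' : ∀ a ∈ maximalIdeal A, a * s = 0) (N : Ideal A) :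
    Submodule.annihilator (Submodule.annihilator N) ≤ N := by
  have hsub : ∀ K : Ideal A, IsFiniteLength A K := fun K =>
    hA.of_injective K.subtype_injective
  have hadd : ∀ K : Ideal A,
      Module.length A A = Module.length A K + Module.length A (A ⧸ K) := fun K =>
    Module.length_eq_add_of_exact K.subtype K.mkQ K.subtype_injective K.mkQ_surjective
      (LinearMap.exact_subtype_mkQ K)
  have h1 : ∀ K : Ideal A,
      Module.length A (Submodule.annihilator K) ≤ Module.length A (A ⧸ K) := by
    intro K
    let j : Submodule.annihilator K →ₗ[A] (A ⧸ K →ₗ[A] A) :=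
      { toFun := fun r => K.liftQ (LinearMap.mulLeft A r.1) fun n hn => by
          simpa using Submodule.mem_annihilator.1 r.2 n hn
        map_add' := fun r r' => LinearMap.ext fun x => by
          obtain ⟨x, rfl⟩ := K.mkQ_surjective x
          exact add_mul r.1 r'.1 x
        map_smul' := fun c r => LinearMap.ext fun x => by
          obtain ⟨x, rfl⟩ := K.mkQ_surjective x
          exact mul_assoc c r.1 x }
    refine (Module.length_le_of_injective j fun r r' h => Subtype.ext ?_).trans
      (length_dual_le hs hs' (hA.of_surjective K.mkQ_surjective))
    have h1 : r.1 * 1 = r'.1 * 1 := LinearMap.congr_fun h (K.mkQ 1)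
    rwa [mul_one, mul_one] at h1
  have h2 : ∀ K : Ideal A,
      Module.length A A ≤ Module.length A (Submodule.annihilator K) + Module.length A K := by
    intro K
    let g : A →ₗ[A] (K →ₗ[A] A) :=
      { toFun := fun r => (LinearMap.mulLeft A r).comp K.subtype
        map_add' := fun r r' => LinearMap.ext fun x => add_mul r r' x
        map_smul' := fun c r => LinearMap.ext fun x => mul_assoc c r x }
    have hg : LinearMap.ker g = Submodule.annihilator K := by
      ext r
      rw [LinearMap.mem_ker, Submodule.mem_annihilator]
      exact ⟨fun h n hn => LinearMap.congr_fun h ⟨n, hn⟩, fun h => LinearMap.ext fun n => h n n.2⟩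
    rw [length_eq_ker_add_range g, hg]
    exact add_le_add le_rfl ((Module.length_le_of_injective _ (Submodule.subtype_injective _)).trans
      (length_dual_le hs hs' (hsub K)))
  have hne : ∀ K : Ideal A, Module.length A K ≠ ⊤ := fun K => Module.length_ne_top_iff.2 (hsub K)
  have hle : N ≤ Submodule.annihilator (Submodule.annihilator N) := fun n hn =>
    Submodule.mem_annihilator.2 fun r hr => by
      rw [smul_eq_mul, mul_comm]
      exact Submodule.mem_annihilator.1 hr n hn
  have h3 : Module.length A (A ⧸ Submodule.annihilator N) ≤ Module.length A N := by
    have := h2 N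
    rw [hadd (Submodule.annihilator N)] at this
    exact (ENat.add_le_add_iff_left (hne _)).1 this
  have h4 := (h1 (Submodule.annihilator N)).trans h3
  obtain ⟨_, _⟩ := isFiniteLength_iff_isNoetherian_isArtinian.1 hA
  by_contra hcon
  have hlt : N < Submodule.annihilator (Submodule.annihilator N) :=
    lt_of_le_of_ne hle fun h => hcon h.ge
  have := Submodule.height_strictMono hlt
  rw [← Module.length_submodule, ← Module.length_submodule] at this
  exact absurd h4 (not_le.2 this)

end Duality

section IdealDuality

open IsLocalRing

variable {R : Type u} [CommRing R] [IsLocalRing R] [IsNoetherianRing R]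

theorem isArtinianRing_quotient_of_maximalIdeal_pow_le {J : Ideal R} {n : ℕ}
    (h : maximalIdeal R ^ n ≤ J) : IsArtinianRing (R ⧸ J) := by
  by_cases hJ : J = ⊤
  · have := Ideal.Quotient.subsingleton_iff.2 hJ
    infer_instance
  · refine IsLocalRing.quotient_artinian_of_mem_minimalPrimes_of_isLocalRing J
      ⟨⟨inferInstance, le_maximalIdeal hJ⟩, fun P hP _ => ?_⟩
    have := hP.1
    exact Ideal.IsPrime.le_of_pow_le (h.trans hP.2)

/-- Duality modulo an `𝔪`-primary ideal `J` such that `R ⧸ J` has simple socle: elements outside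
an ideal `N ≥ J` are detected by multipliers in `J : N`. -/
theorem HasSimpleSocle.exists_mul_notMem {J : Ideal R} (hJ : HasSimpleSocle J) {n : ℕ}
    (hn : maximalIdeal R ^ n ≤ J) {N : Ideal R} (hN : J ≤ N) {f : R} (hf : f ∉ N) :
    ∃ r, (∀ x ∈ N, r * x ∈ J) ∧ r * f ∉ J := by
  obtain ⟨s, hs1, hs2, hs3⟩ := hJ
  have : Nontrivial (R ⧸ J) := Ideal.Quotient.nontrivial_iff.2 fun h => hs1 (h ▸ trivial)
  have hloc : IsLocalRing (R ⧸ J) :=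
    .of_surjective' (Ideal.Quotient.mk J) Ideal.Quotient.mk_surjective
  have := isArtinianRing_quotient_of_maximalIdeal_pow_le hn
  have hA := (isArtinianRing_iff_isFiniteLength (R ⧸ J)).1 this
  have hmax : ∀ a ∈ maximalIdeal R, Ideal.Quotient.mk J a ∈ maximalIdeal (R ⧸ J) := by
    intro a ha hu
    have := IsLocalHom.of_surjective (Ideal.Quotient.mk J) Ideal.Quotient.mk_surjective
    exact ha (isUnit_of_map_unit (Ideal.Quotient.mk J) a hu)
  have hmax' : ∀ a, Ideal.Quotient.mk J a ∈ maximalIdeal (R ⧸ J) → a ∈ maximalIdeal R :=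
    fun a ha hu => ha (hu.map _)
  have key := annihilator_annihilator_le hA (s := Ideal.Quotient.mk J s) ?_ ?_
    (N.map (Ideal.Quotient.mk J))
  · by_contra! hcon
    refine hf ?_
    have hfm : Ideal.Quotient.mk J f ∈ N.map (Ideal.Quotient.mk J) := by
      refine key (Submodule.mem_annihilator.2 fun r hr => ?_)
      obtain ⟨r, rfl⟩ := Ideal.Quotient.mk_surjective r
      rw [smul_eq_mul, ← map_mul, Ideal.Quotient.eq_zero_iff_mem, mul_comm]
      refine hcon r fun x hx => ?_
      have := Submodule.mem_annihilator.1 hr _ (Ideal.mem_map_of_mem _ hx)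
      rwa [smul_eq_mul, ← map_mul, Ideal.Quotient.eq_zero_iff_mem] at this
    rw [← Ideal.mem_comap, Ideal.comap_map_of_surjective _ Ideal.Quotient.mk_surjective] at hfm
    rwa [← RingHom.ker_eq_comap_bot, Ideal.mk_ker, sup_eq_left.2 hN] at hfm
  · intro g hg
    obtain ⟨g, rfl⟩ := Ideal.Quotient.mk_surjective g
    have := hs3 g fun a ha => by
      have := hg _ (hmax a ha)
      rwa [← map_mul, Ideal.Quotient.eq_zero_iff_mem] at this
    obtain ⟨j, hj, t, ht, rfl⟩ := Submodule.mem_sup.1 this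
    obtain ⟨b, rfl⟩ := Ideal.mem_span_singleton'.1 ht
    rw [map_add, Ideal.Quotient.eq_zero_iff_mem.2 hj, zero_add, map_mul]
    exact Ideal.mem_span_singleton'.2 ⟨_, rfl⟩
  · intro a ha
    obtain ⟨a, rfl⟩ := Ideal.Quotient.mk_surjective a
    rw [← map_mul, Ideal.Quotient.eq_zero_iff_mem]
    exact hs2 a (hmax' a ha)

end IdealDuality

/-! ### Vanishing of the first Tor on modules of finite length -/

section Tor

open IsLocalRing RingTheory.Sequence

variable {R : Type u} [CommRing R] (T : Type u) [AddCommGroup T] [Module R T]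

/-- The condition `Tor₁(T, Q) = 0`, phrased without derived functors: tensoring any presentation
`0 → K → P → Q → 0` with `T` keeps the first map injective. -/
def TorOneVanishes (Q : Type u) [AddCommGroup Q] [Module R Q] : Prop :=
  ∀ (K P : Type u) [AddCommGroup K] [Module R K] [AddCommGroup P] [Module R P]
    (i : K →ₗ[R] P) (g : P →ₗ[R] Q), Function.Injective i → Function.Exact i g →
    Function.Surjective g → Function.Injective (i.lTensor T)

variable {T}

theorem TorOneVanishes.of_subsingleton {Q : Type u} [AddCommGroup Q] [Module R Q]
    [Subsingleton Q] : TorOneVanishes (R := R) T Q := by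
  intro K P _ _ _ _ i g hi hex _
  have hs : Function.Surjective i := fun x => (hex x).1 (Subsingleton.elim _ _)
  exact (LinearEquiv.lTensor T (LinearEquiv.ofBijective i ⟨hi, hs⟩)).injective

theorem TorOneVanishes.of_equiv {Q Q' : Type u} [AddCommGroup Q] [Module R Q] [AddCommGroup Q']
    [Module R Q'] (e : Q ≃ₗ[R] Q') (h : TorOneVanishes (R := R) T Q) :
    TorOneVanishes (R := R) T Q' := by
  intro K P _ _ _ _ i g hi hex hg
  refine h K P i (e.symm.toLinearMap ∘ₗ g) hi (fun x => ?_) (e.symm.surjective.comp hg)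
  rw [← hex x]
  simp

theorem TorOneVanishes.of_extension {Q : Type u} [AddCommGroup Q] [Module R Q]
    (N : Submodule R Q) (h1 : TorOneVanishes (R := R) T N)
    (h2 : TorOneVanishes (R := R) T (Q ⧸ N)) : TorOneVanishes (R := R) T Q := by
  intro K P _ _ _ _ i g hi hex hg
  let K' : Submodule R P := N.comap g
  have hiK : ∀ k, i k ∈ K' := fun k => by
    change g (i k) ∈ N
    rw [hex.apply_apply_eq_zero]
    exact N.zero_mem
  let i' : K →ₗ[R] K' := i.codRestrict K' hiK
  let g' : K' →ₗ[R] N := g.restrict fun x hx => hx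
  have e1 : Function.Injective (i'.lTensor T) := by
    refine h1 K K' i' g' (fun a b h => hi (congrArg Subtype.val h)) (fun x => ?_) ?_
    · constructor
      · intro h
        obtain ⟨k, hk⟩ := (hex x.1).1 (congrArg Subtype.val h)
        exact ⟨k, Subtype.ext hk⟩
      · rintro ⟨k, rfl⟩
        exact Subtype.ext (hex.apply_apply_eq_zero k)
    · rintro ⟨n, hn⟩
      obtain ⟨x, rfl⟩ := hg n
      exact ⟨⟨x, hn⟩, rfl⟩
  have e2 : Function.Injective (K'.subtype.lTensor T) := by
    refine h2 K' P K'.subtype (N.mkQ ∘ₗ g) K'.subtype_injective (fun x => ?_)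
      (N.mkQ_surjective.comp hg)
    rw [LinearMap.comp_apply, N.mkQ_apply, Submodule.Quotient.mk_eq_zero]
    exact ⟨fun h => ⟨⟨x, h⟩, rfl⟩, by rintro ⟨y, rfl⟩; exact y.2⟩
  have : i.lTensor T = K'.subtype.lTensor T ∘ₗ i'.lTensor T := by
    rw [← LinearMap.lTensor_comp]
    rfl
  rw [this]
  exact e2.comp e1

/-- For a cyclic module it suffices to test the standard presentation. -/
theorem TorOneVanishes.of_ideal {J : Ideal R} (hJ : Function.Injective (J.subtype.lTensor T)) :
    TorOneVanishes (R := R) T (R ⧸ J) := by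
  intro K P _ _ _ _ i g hi hex hg
  obtain ⟨p₀, hp₀⟩ := hg (Submodule.Quotient.mk 1)
  have hgp : ∀ r : R, g (r • p₀) = Submodule.Quotient.mk r := fun r => by
    rw [map_smul, hp₀, ← Submodule.Quotient.mk_smul, smul_eq_mul, mul_one]
  -- `P` is the pushout of `K` and `R` along `J`
  let φ : K × R →ₗ[R] P := i.coprod (LinearMap.toSpanSingleton R P p₀)
  have hφ : Function.Surjective φ := by
    intro x
    obtain ⟨r, hr⟩ := Submodule.Quotient.mk_surjective _ (g x)
    obtain ⟨k, hk⟩ := (hex (x - r • p₀)).1 (by rw [map_sub, hgp, hr, sub_self])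
    exact ⟨(k, r), by simp [φ, hk]⟩
  have hmem : ∀ x : LinearMap.ker φ, x.1.2 ∈ J := by
    rintro ⟨⟨k, r⟩, hx⟩
    have hx' : i k + r • p₀ = 0 := by simpa [φ] using hx
    have := congrArg g hx'
    rw [map_add, hex.apply_apply_eq_zero, zero_add, hgp, map_zero,
      Submodule.Quotient.mk_eq_zero] at this
    exact this
  let π : LinearMap.ker φ →ₗ[R] J :=
    (LinearMap.snd R K R ∘ₗ (LinearMap.ker φ).subtype).codRestrict J hmem
  have hπ : Function.Bijective π := by
    constructor
    · rw [← LinearMap.ker_eq_bot, LinearMap.ker_eq_bot']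
      rintro ⟨⟨k, r⟩, hx⟩ h
      obtain rfl : r = 0 := congrArg Subtype.val h
      have hx' : i k = i 0 := by simpa [φ] using hx
      obtain rfl := hi hx'
      rfl
    · rintro ⟨a, ha⟩
      obtain ⟨k, hk⟩ := (hex (-(a • p₀))).1 (by
        rw [map_neg, hgp, (Submodule.Quotient.mk_eq_zero J).2 ha, neg_zero])
      exact ⟨⟨(k, a), by simp [φ, hk]⟩, rfl⟩
  have hexφ : Function.Exact ((LinearMap.ker φ).subtype.lTensor T) (φ.lTensor T) :=
    lTensor_exact T (LinearMap.exact_subtype_ker_map φ) hφ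
  rw [← LinearMap.ker_eq_bot, LinearMap.ker_eq_bot']
  intro t ht
  obtain ⟨w, hw⟩ := (hexφ ((LinearMap.inl R K R).lTensor T t)).1 (by
    rw [← LinearMap.comp_apply, ← LinearMap.lTensor_comp, LinearMap.coprod_inl, ht])
  have hw0 : w = 0 := by
    apply (LinearEquiv.lTensor T (LinearEquiv.ofBijective π hπ)).injective
    apply hJ
    rw [map_zero, map_zero]
    have h1 : J.subtype ∘ₗ π = LinearMap.snd R K R ∘ₗ (LinearMap.ker φ).subtype := rfl
    change J.subtype.lTensor T (π.lTensor T w) = 0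
    rw [← LinearMap.comp_apply, ← LinearMap.lTensor_comp, h1, LinearMap.lTensor_comp,
      LinearMap.comp_apply, hw, ← LinearMap.comp_apply, ← LinearMap.lTensor_comp,
      LinearMap.snd_comp_inl, LinearMap.lTensor_zero, LinearMap.zero_apply]
  rw [hw0, map_zero] at hw
  have := congrArg ((LinearMap.fst R K R).lTensor T) hw
  rw [map_zero, ← LinearMap.comp_apply, ← LinearMap.lTensor_comp, LinearMap.fst_comp_inl,
    LinearMap.lTensor_id, LinearMap.id_apply] at this
  exact this.symm

theorem mem_smul_top_iff_exists_lTensor (J : Ideal R) (t : T) : t ∈ (J • ⊤ : Submodule R T) ↔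
    ∃ w : T ⊗[R] J, TensorProduct.rid R T (J.subtype.lTensor T w) = t := by
  constructor
  · intro h
    induction h using Submodule.smul_induction_on' with
    | smul a ha t _ => exact ⟨t ⊗ₜ ⟨a, ha⟩, by simp⟩
    | add x _ y _ hx hy =>
      obtain ⟨v, hv⟩ := hx
      obtain ⟨w, hw⟩ := hy
      exact ⟨v + w, by rw [map_add, map_add, hv, hw]⟩
  · rintro ⟨w, rfl⟩
    induction w with
    | zero => simp
    | tmul t a => simpa using Submodule.smul_mem_smul a.2 (Submodule.mem_top (x := t))
    | add x y hx hy => rw [map_add, map_add]; exact add_mem hx hy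

theorem lTensor_injective_sup_span {J : Ideal R} (hJ : Function.Injective (J.subtype.lTensor T))
    {x : R} (hx : ∀ t : T, x • t ∈ (J • ⊤ : Submodule R T) → t ∈ (J • ⊤ : Submodule R T)) :
    Function.Injective ((J ⊔ Ideal.span {x}).subtype.lTensor T) := by
  have hxm : x ∈ J ⊔ Ideal.span {x} := Ideal.mem_sup_right (Ideal.mem_span_singleton_self x)
  let incl : J →ₗ[R] (J ⊔ Ideal.span {x} : Ideal R) := Submodule.inclusion le_sup_left
  have hincl : (J ⊔ Ideal.span {x}).subtype ∘ₗ incl = J.subtype := rfl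
  have hform : ∀ w : T ⊗[R] (J ⊔ Ideal.span {x} : Ideal R), ∃ (v : T ⊗[R] J) (t : T),
      w = incl.lTensor T v + t ⊗ₜ ⟨x, hxm⟩ := by
    intro w
    induction w with
    | zero => exact ⟨0, 0, by simp⟩
    | tmul t y =>
      obtain ⟨y, hy⟩ := y
      obtain ⟨a, ha, b, hb, rfl⟩ := Submodule.mem_sup.1 hy
      obtain ⟨r, rfl⟩ := Ideal.mem_span_singleton'.1 hb
      refine ⟨t ⊗ₜ ⟨a, ha⟩, r • t, ?_⟩
      rw [LinearMap.lTensor_tmul, TensorProduct.smul_tmul, ← TensorProduct.tmul_add]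
      rfl
    | add w w' h h' =>
      obtain ⟨v, t, rfl⟩ := h
      obtain ⟨v', t', rfl⟩ := h'
      exact ⟨v + v', t + t', by rw [map_add, TensorProduct.add_tmul]; abel⟩
  have hmul : ∀ v : T ⊗[R] J,
      TensorProduct.rid R T (J.subtype.lTensor T v) ⊗ₜ[R] (⟨x, hxm⟩ : (J ⊔ Ideal.span {x} : Ideal R))
        = incl.lTensor T (x • v) := by
    intro v
    induction v with
    | zero => simp
    | tmul t a =>
      rw [LinearMap.lTensor_tmul, TensorProduct.rid_tmul, TensorProduct.smul_tmul,
        ← TensorProduct.tmul_smul, LinearMap.lTensor_tmul]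
      exact congrArg (t ⊗ₜ[R] ·) (Subtype.ext (mul_comm a.1 x))
    | add v w hv hw => rw [map_add, map_add, TensorProduct.add_tmul, hv, hw, smul_add, map_add]
  have hcomp : ∀ v, (J ⊔ Ideal.span {x}).subtype.lTensor T (incl.lTensor T v) =
      J.subtype.lTensor T v := fun v => by
    rw [← LinearMap.comp_apply, ← LinearMap.lTensor_comp, hincl]
  rw [← LinearMap.ker_eq_bot, LinearMap.ker_eq_bot']
  intro w hw
  obtain ⟨v, t, rfl⟩ := hform w
  have ht : x • t ∈ (J • ⊤ : Submodule R T) := by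
    refine (mem_smul_top_iff_exists_lTensor J _).2 ⟨-v, ?_⟩
    have := congrArg (TensorProduct.rid R T) hw
    rw [map_add, map_add, hcomp, LinearMap.lTensor_tmul, map_zero] at this
    rw [map_neg, map_neg, neg_eq_iff_add_eq_zero]
    simpa using this
  obtain ⟨v', rfl⟩ := (mem_smul_top_iff_exists_lTensor J t).1 (hx t ht)
  rw [hmul, ← map_add] at hw ⊢
  rw [hcomp] at hw
  rw [hJ (hw.trans (map_zero _).symm), map_zero]

theorem lTensor_injective_of_isWeaklyRegular (l : List R) (h : IsWeaklyRegular T l) :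
    Function.Injective ((Ideal.ofList l).subtype.lTensor T) := by
  induction l using List.reverseRecOn with
  | nil =>
    rw [Ideal.ofList_nil, ← LinearMap.ker_eq_bot, LinearMap.ker_eq_bot']
    intro w _
    have : Subsingleton (T ⊗[R] (⊥ : Ideal R)) := inferInstance
    exact Subsingleton.elim _ _
  | append_singleton l x ih =>
    rw [isWeaklyRegular_concat_iff] at h
    rw [Ideal.ofList_append, Ideal.ofList_singleton]
    exact lTensor_injective_sup_span (ih h.1) h.2

/-- If the maximal ideal is generated by a sequence that is weakly regular on `T`, then `T` behaves
like a flat module with respect to modules of finite length. -/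
theorem TorOneVanishes.of_isFiniteLength [IsLocalRing R] {l : List R}
    (hl : Ideal.ofList l = maximalIdeal R) (h : IsWeaklyRegular T l) {Q : Type u}
    [AddCommGroup Q] [Module R Q] (hQ : IsFiniteLength R Q) : TorOneVanishes (R := R) T Q := by
  induction hQ with
  | of_subsingleton => exact .of_subsingleton
  | @of_simple_quotient M _ _ N hs _ ih =>
    refine .of_extension N ih ?_
    obtain ⟨I, hI, ⟨e⟩⟩ := isSimpleModule_iff_quot_maximal.1 hs
    obtain rfl := eq_maximalIdeal hI
    refine .of_equiv e.symm (.of_ideal ?_)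
    rw [← hl]
    exact lTensor_injective_of_isWeaklyRegular l h

theorem lTensor_injective_of_isFiniteLength [IsLocalRing R] {l : List R}
    (hl : Ideal.ofList l = maximalIdeal R) (h : IsWeaklyRegular T l) {K P : Type u}
    [AddCommGroup K] [Module R K] [AddCommGroup P] [Module R P] (i : K →ₗ[R] P)
    (hi : Function.Injective i) (hP : IsFiniteLength R (P ⧸ LinearMap.range i)) :
    Function.Injective (i.lTensor T) :=
  TorOneVanishes.of_isFiniteLength hl h hP K P i _ hi (LinearMap.exact_map_mkQ_range i)
    (Submodule.mkQ_surjective _)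

end Tor

/-! ### Frobenius powers of ideals and annihilators in Frobenius pullbacks -/

section FrobeniusPowers

open IsLocalRing RingTheory.Sequence

variable {R : Type u} [CommRing R] (p : ℕ) [ExpChar R p]

/-- The Frobenius power `J^{[q]}`, `q = p ^ e`: the ideal generated by the `q`-th powers of the
elements of `J`, that is, the extension of `J` along the iterated Frobenius. -/
noncomputable def frobeniusPower (e : ℕ) (J : Ideal R) : Ideal R :=
  J.map (iterateFrobenius R p e)

variable {p}

theorem pow_mem_frobeniusPower {e : ℕ} {J : Ideal R} {a : R} (ha : a ∈ J) :
    a ^ p ^ e ∈ frobeniusPower p e J := by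
  rw [← iterateFrobenius_def]
  exact Ideal.mem_map_of_mem _ ha

theorem frobeniusPower_le {e : ℕ} {J K : Ideal R} :
    frobeniusPower p e J ≤ K ↔ ∀ a ∈ J, a ^ p ^ e ∈ K := by
  rw [frobeniusPower, Ideal.map_le_iff_le_comap]
  exact forall₂_congr fun a _ => by rw [Ideal.mem_comap, iterateFrobenius_def]

theorem frobeniusPower_mono {e : ℕ} {J K : Ideal R} (h : J ≤ K) :
    frobeniusPower p e J ≤ frobeniusPower p e K :=
  Ideal.map_mono h

theorem frobeniusPower_le_pow (e : ℕ) (J : Ideal R) : frobeniusPower p e J ≤ J ^ p ^ e :=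
  frobeniusPower_le.2 fun _ ha => Ideal.pow_mem_pow ha _

theorem frobeniusPower_add (e e' : ℕ) (J : Ideal R) :
    frobeniusPower p (e + e') J = frobeniusPower p e (frobeniusPower p e' J) := by
  rw [frobeniusPower, frobeniusPower, frobeniusPower, Ideal.map_map]
  congr 1
  ext x
  simp [iterateFrobenius_def, ← pow_mul, pow_add, mul_comm]

theorem frobeniusPower_ofList (e : ℕ) (l : List R) :
    frobeniusPower p e (Ideal.ofList l) = Ideal.ofList (l.map (· ^ p ^ e)) := by
  rw [frobeniusPower, Ideal.map_ofList]
  congr 2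

theorem frobeniusElement_smul (e : ℕ) {M : Type u} [AddCommGroup M] [Module R M] (a : R) (z : M) :
    frobeniusElement R p e (a • z)
      = FrobeniusCopy.equiv R p e (a ^ p ^ e) • frobeniusElement R p e z := by
  rw [← FrobeniusCopy.algebraMap_apply, algebraMap_smul]
  simp [frobeniusElement]

theorem smul_frobeniusElement_eq_tmul (e : ℕ) {M : Type u} [AddCommGroup M] [Module R M] (x : R)
    (z : M) : FrobeniusCopy.equiv R p e x • frobeniusElement R p e z
      = FrobeniusCopy.equiv R p e x ⊗ₜ[R] z := by
  rw [frobeniusElement, TensorProduct.smul_tmul', smul_eq_mul, mul_one]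

theorem smul_frobeniusElement_eq_zero {e : ℕ} {M : Type u} [AddCommGroup M] [Module R M] {z : M}
    {J : Ideal R} (hJ : ∀ a ∈ J, a • z = 0) {x : R} (hx : x ∈ frobeniusPower p e J) :
    FrobeniusCopy.equiv R p e x • frobeniusElement R p e z = 0 := by
  let K : Ideal R := Ideal.comap (FrobeniusCopy.equiv R p e).toRingHom
    (LinearMap.ker (LinearMap.toSpanSingleton (FrobeniusCopy R p e) _ (frobeniusElement R p e z)))
  suffices frobeniusPower p e J ≤ K from this hx
  refine frobeniusPower_le.2 fun a ha => ?_
  change FrobeniusCopy.equiv R p e (a ^ p ^ e) • frobeniusElement R p e z = 0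
  rw [← frobeniusElement_smul, hJ a ha, frobeniusElement, TensorProduct.tmul_zero]

theorem mem_frobeniusPower_of_equiv_mem {e : ℕ} {J : Ideal R} {x : R}
    (hx : FrobeniusCopy.equiv R p e x ∈ (J • ⊤ : Submodule R (FrobeniusCopy R p e))) :
    x ∈ frobeniusPower p e J := by
  suffices ∀ t : FrobeniusCopy R p e, t ∈ (J • ⊤ : Submodule R (FrobeniusCopy R p e)) →
      (FrobeniusCopy.equiv R p e).symm t ∈ frobeniusPower p e J by
    simpa using this _ hx
  intro t ht
  induction ht using Submodule.smul_induction_on' with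
  | smul a ha t _ =>
    rw [Algebra.smul_def, FrobeniusCopy.algebraMap_apply, map_mul, RingEquiv.symm_apply_apply]
    exact Ideal.mul_mem_right _ _ (pow_mem_frobeniusPower ha)
  | add x _ y _ hx hy => rw [map_add]; exact add_mem hx hy

variable [IsLocalRing R] [IsNoetherianRing R] {l : List R}

theorem isWeaklyRegular_frobeniusCopy (hreg : IsRegular R l) (e : ℕ) :
    IsWeaklyRegular (FrobeniusCopy R p e) l := by
  have h1 : IsWeaklyRegular R (l.map (· ^ p ^ e)) :=
    (isRegular_map_pow hreg (pow_pos (expChar_pos R p) e)).1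
  exact (isWeaklyRegular_map_algebraMap_iff (FrobeniusCopy R p e) (FrobeniusCopy R p e) l).1 h1

/-- The consequence of the flatness of Frobenius on which everything rests: if `z` has annihilator
`J`, then `z^q` has annihilator `J^{[q]}`. -/
theorem mem_frobeniusPower_of_smul_eq_zero (hl : Ideal.ofList l = maximalIdeal R)
    (hreg : IsRegular R l) {e : ℕ} {M : Type u} [AddCommGroup M] [Module R M]
    (hM : IsFiniteLength R M) {z : M} {J : Ideal R} (hJ : ∀ a : R, a • z = 0 → a ∈ J) {x : R}
    (hx : FrobeniusCopy.equiv R p e x • frobeniusElement R p e z = 0) :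
    x ∈ frobeniusPower p e J := by
  let f : R →ₗ[R] M := LinearMap.toSpanSingleton R M z
  let J₀ : Ideal R := LinearMap.ker f
  let i : (R ⧸ J₀) →ₗ[R] M := J₀.liftQ f le_rfl
  have hi : Function.Injective i := LinearMap.ker_eq_bot.1 (Submodule.ker_liftQ_eq_bot _ _ _ le_rfl)
  have hT := lTensor_injective_of_isFiniteLength hl (isWeaklyRegular_frobeniusCopy (p := p) hreg e)
    i hi (hM.of_surjective (Submodule.mkQ_surjective _))
  rw [smul_frobeniusElement_eq_tmul] at hx
  have h0 : J₀.mkQ.lTensor (FrobeniusCopy R p e) (FrobeniusCopy.equiv R p e x ⊗ₜ[R] (1 : R)) = 0 := by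
    apply hT
    rw [map_zero, LinearMap.lTensor_tmul, LinearMap.lTensor_tmul]
    change FrobeniusCopy.equiv R p e x ⊗ₜ[R] ((1 : R) • z) = 0
    rw [one_smul, hx]
  obtain ⟨w, hw⟩ := (lTensor_exact (FrobeniusCopy R p e) (LinearMap.exact_subtype_mkQ J₀)
    J₀.mkQ_surjective _).1 h0
  refine frobeniusPower_mono (fun a ha => hJ a ha) (mem_frobeniusPower_of_equiv_mem
    ((mem_smul_top_iff_exists_lTensor J₀ _).2 ⟨w, ?_⟩))
  rw [hw, TensorProduct.rid_tmul, one_smul]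

end FrobeniusPowers

section FiniteLength

open IsLocalRing

variable {R : Type u} [CommRing R] [IsLocalRing R] [IsNoetherianRing R]

theorem isFiniteLength_quotient {J : Ideal R} {n : ℕ} (h : maximalIdeal R ^ n ≤ J) :
    IsFiniteLength R (R ⧸ J) := by
  have := isArtinianRing_quotient_of_maximalIdeal_pow_le h
  refine isFiniteLength_iff_isNoetherian_isArtinian.2 ⟨inferInstance, ?_⟩
  exact isArtinian_of_surjective_algebraMap (S := R) (M := R ⧸ J) (R := R ⧸ J)
    Ideal.Quotient.mk_surjective

theorem isFiniteLength_quotient_pow_smul (M : Type u) [AddCommGroup M] [Module R M]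
    [Module.Finite R M] (n : ℕ) :
    IsFiniteLength R (M ⧸ (maximalIdeal R ^ n • ⊤ : Submodule R M)) := by
  have := isArtinianRing_quotient_of_maximalIdeal_pow_le (le_refl (maximalIdeal R ^ n))
  refine isFiniteLength_iff_isNoetherian_isArtinian.2 ⟨inferInstance, ?_⟩
  have : Module.Finite (R ⧸ maximalIdeal R ^ n) (M ⧸ (maximalIdeal R ^ n • ⊤ : Submodule R M)) :=
    Module.Finite.of_restrictScalars_finite R _ _
  have : IsArtinian (R ⧸ maximalIdeal R ^ n) (M ⧸ (maximalIdeal R ^ n • ⊤ : Submodule R M)) :=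
    inferInstance
  exact isArtinian_of_surjective_algebraMap (S := R) (R := R ⧸ maximalIdeal R ^ n)
    Ideal.Quotient.mk_surjective

end FiniteLength

/-! ### A criterion for the triviality of a generalized test ideal -/

section TestIdeal

open IsLocalRing RingTheory.Sequence

theorem exists_maximalIdeal_pow_le_frobeniusPower {R : Type u} [CommRing R] [IsLocalRing R]
    [IsNoetherianRing R] {p : ℕ} [ExpChar R p] (e : ℕ) {J : Ideal R} {n : ℕ}
    (hJ : maximalIdeal R ^ n ≤ J) :
    ∃ k, maximalIdeal R ^ k ≤ frobeniusPower p e J := by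
  refine Ideal.exists_pow_le_of_le_radical_of_fg (fun a ha => ?_)
    (IsNoetherian.noetherian (maximalIdeal R))
  refine ⟨n * p ^ e, ?_⟩
  rw [pow_mul]
  exact pow_mem_frobeniusPower (hJ (Ideal.pow_mem_pow ha n))

theorem eq_zero_of_forall_mem_maximalIdeal_pow {R : Type u} [CommRing R] [IsLocalRing R]
    [IsNoetherianRing R] {c : R} {e₀ : ℕ} (h : ∀ e ≥ e₀, c ∈ maximalIdeal R ^ e) : c = 0 := by
  rw [← Ideal.mem_bot, ← Ideal.iInf_pow_eq_bot_of_isLocalRing (maximalIdeal R)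
    (maximalIdeal.isMaximal R).ne_top, Ideal.mem_iInf]
  exact fun e => Ideal.pow_le_pow_right (le_max_left e e₀) (h _ (le_max_right e e₀))

theorem mem_maximalIdeal_of_smul_eq_zero {R M : Type*} [CommRing R] [IsLocalRing R]
    [AddCommGroup M] [Module R M] {z : M} (hz : z ≠ 0) {a : R} (ha : a • z = 0) :
    a ∈ maximalIdeal R :=
  (mem_maximalIdeal a).2 fun hu => hz (hu.smul_eq_zero.1 ha)

theorem smul_frobeniusElement_map {R : Type u} [CommRing R] {p : ℕ} [ExpChar R p] {e : ℕ}
    {M M' : Type u} [AddCommGroup M] [Module R M] [AddCommGroup M'] [Module R M'] (φ : M →ₗ[R] M')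
    {x : R} {z : M} (h : FrobeniusCopy.equiv R p e x • frobeniusElement R p e z = 0) :
    FrobeniusCopy.equiv R p e x • frobeniusElement R p e (φ z) = 0 := by
  rw [smul_frobeniusElement_eq_tmul] at h ⊢
  simpa using congrArg (φ.lTensor (FrobeniusCopy R p e)) h

/-- The generalized test ideal of a family `𝔞` is trivial as soon as the powers `u ^ q` of an
element `u ∉ 𝔪^{[p]}` lie in `𝔞_{pq}`: otherwise some `c ≠ 0` satisfies `c u ^ q ∈ 𝔪^{[pq]}` for all
large `q`, so that `c ∈ (𝔪^{[p]} : u)^{[q]} ⊆ 𝔪^{[q]}`, against Krull's intersection theorem. -/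
theorem generalizedTestIdeal_eq_top {R : Type u} [CommRing R] [IsLocalRing R] [IsNoetherianRing R]
    (p : ℕ) [Fact p.Prime] [CharP R p] {l : List R} (hl : Ideal.ofList l = maximalIdeal R)
    (hreg : IsRegular R l) {𝔞 : ℕ → Ideal R} {u : R}
    (hu : u ∉ frobeniusPower p 1 (maximalIdeal R)) (h𝔞 : ∀ e, u ^ p ^ e ∈ 𝔞 (p ^ (e + 1))) :
    generalizedTestIdeal p 𝔞 1 = ⊤ := by
  refine eq_top_iff.2 (le_iInf fun M => le_iInf fun _ => le_iInf fun _ => le_iInf fun _ => ?_)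
  suffices h : tightClosure p 𝔞 1 (⊥ : Submodule R M) = ⊥ by
    rw [h, Submodule.annihilator_bot]
  refine (Submodule.eq_bot_iff _).2 fun z hz => ?_
  obtain ⟨c, hc, e₀, h⟩ := hz
  by_contra hz0
  obtain ⟨n, hn⟩ : ∃ n, z ∉ (maximalIdeal R ^ n • ⊤ : Submodule R M) := by
    by_contra! hcon
    have := (Submodule.mem_iInf _).2 hcon
    rw [Ideal.iInf_pow_smul_eq_bot_of_isLocalRing _ (maximalIdeal.isMaximal R).ne_top] at this
    exact hz0 this
  have hc' : ∀ e ≥ e₀, c ∈ maximalIdeal R ^ e := by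
    intro e he
    have h1 : FrobeniusCopy.equiv R p (e + 1) (c * u ^ p ^ e) • frobeniusElement R p (e + 1) z
        = 0 := by
      have := h (e + 1) (by omega) (u ^ p ^ e) (by rw [one_mul]; exact h𝔞 e)
      obtain ⟨w, hw⟩ := this
      have hsub : Subsingleton (FrobeniusCopy R p (e + 1) ⊗[R] (⊥ : Submodule R M)) := inferInstance
      rw [← hw, Subsingleton.elim w 0, map_zero]
    have h2 := smul_frobeniusElement_map (maximalIdeal R ^ n • ⊤ : Submodule R M).mkQ h1
    have h3 : c * u ^ p ^ e ∈ frobeniusPower p (e + 1) (maximalIdeal R) := by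
      refine mem_frobeniusPower_of_smul_eq_zero hl hreg (isFiniteLength_quotient_pow_smul M n)
        (fun a ha => mem_maximalIdeal_of_smul_eq_zero (fun h => hn ?_) ha) h2
      exact (Submodule.Quotient.mk_eq_zero _).1 h
    rw [frobeniusPower_add] at h3
    obtain ⟨k, hk⟩ := exists_maximalIdeal_pow_le_frobeniusPower (p := p) 1
      (pow_one (maximalIdeal R)).le
    have h4 : c ∈ frobeniusPower p e (maximalIdeal R) := by
      let K := frobeniusPower p 1 (maximalIdeal R)
      refine mem_frobeniusPower_of_smul_eq_zero hl hreg (isFiniteLength_quotient hk)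
        (z := (Submodule.Quotient.mk u : R ⧸ K))
        (fun a ha => mem_maximalIdeal_of_smul_eq_zero (fun h => hu ?_) ha) ?_
      · exact (Submodule.Quotient.mk_eq_zero _).1 h
      · have : (Submodule.Quotient.mk u : R ⧸ K) = u • Submodule.Quotient.mk 1 := by
          rw [← Submodule.Quotient.mk_smul, smul_eq_mul, mul_one]
        rw [this, frobeniusElement_smul, smul_smul, ← map_mul]
        refine smul_frobeniusElement_eq_zero (J := K) (fun a ha => ?_) h3
        rw [← Submodule.Quotient.mk_smul, smul_eq_mul, mul_one, Submodule.Quotient.mk_eq_zero]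
        exact ha
    exact Ideal.pow_le_pow_right (Nat.lt_pow_self (Fact.out : p.Prime).one_lt).le
      (frobeniusPower_le_pow e _ h4)
  obtain rfl := eq_zero_of_forall_mem_maximalIdeal_pow hc'
  obtain ⟨P, hP⟩ := Ideal.nonempty_minimalPrimes (bot_ne_top (α := Ideal R))
  exact hc P hP P.zero_mem

end TestIdeal

/-! ### Fedder's criterion -/

section Fedder

open IsLocalRing RingTheory.Sequence

variable {R : Type u} [CommRing R] {p : ℕ} [Fact p.Prime]

/-- Purity of the Frobenius of `R ⧸ I`, tested on the `R ⧸ I`-module `L ⧸ J`. -/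
theorem IsFPure.pow_notMem [CharP R p] {I J L : Ideal R} (hpure : IsFPure p (R ⧸ I))
    (hJL : J ≤ L) (hIL : ∀ a ∈ I, ∀ f ∈ L, a * f ∈ J)
    (hL : Function.Injective (L.subtype.lTensor (FrobeniusCopy R p 1))) {s : R} (hsL : s ∈ L)
    (hsJ : s ∉ J) : s ^ p ∉ frobeniusPower p 1 J ⊔ I * frobeniusPower p 1 L := by
  obtain ⟨_, hpure⟩ := hpure
  intro hs
  let M := L ⧸ J.submoduleOf L
  have htors : Module.IsTorsionBySet R M (I : Set R) := by
    intro x a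
    obtain ⟨x, rfl⟩ := Submodule.Quotient.mk_surjective _ x
    change (a : R) • (Submodule.Quotient.mk x : M) = 0
    rw [← Submodule.Quotient.mk_smul, Submodule.Quotient.mk_eq_zero]
    exact hIL a.1 a.2 x.1 x.2
  let : Module (R ⧸ I) M := htors.module
  let T := FrobeniusCopy R p 1
  let T' := FrobeniusCopy (R ⧸ I) p 1
  let π : T →+* T' := (FrobeniusCopy.equiv (R ⧸ I) p 1).toRingHom.comp
    ((Ideal.Quotient.mk I).comp (FrobeniusCopy.equiv R p 1).symm.toRingHom)
  have hπ : ∀ (r : R) (t : T), π (r • t) = Ideal.Quotient.mk I r • π t := by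
    intro r t
    rw [Algebra.smul_def, Algebra.smul_def, map_mul, FrobeniusCopy.algebraMap_apply,
      FrobeniusCopy.algebraMap_apply, ← map_pow]
    rfl
  let Φ : T ⊗[R] L →+ T' ⊗[R ⧸ I] M := TensorProduct.liftAddHom
    { toFun := fun t =>
        { toFun := fun x => π t ⊗ₜ (Submodule.Quotient.mk x : M)
          map_zero' := by rw [Submodule.Quotient.mk_zero, TensorProduct.tmul_zero]
          map_add' := fun x y => by rw [Submodule.Quotient.mk_add, TensorProduct.tmul_add] }
      map_zero' := by
        ext x
        change π 0 ⊗ₜ[R ⧸ I] (Submodule.Quotient.mk x : M) = 0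
        rw [map_zero, TensorProduct.zero_tmul]
      map_add' := fun t t' => by
        ext x
        change π (t + t') ⊗ₜ[R ⧸ I] (Submodule.Quotient.mk x : M) = _
        rw [map_add, TensorProduct.add_tmul]
        rfl }
    fun r t x => by
      change π (r • t) ⊗ₜ[R ⧸ I] (Submodule.Quotient.mk x : M) =
        π t ⊗ₜ[R ⧸ I] (Submodule.Quotient.mk (r • x) : M)
      rw [hπ, TensorProduct.smul_tmul]
      rfl
  have hΦ : ∀ (t : T) (x : L), Φ (t ⊗ₜ x) = π t ⊗ₜ (Submodule.Quotient.mk x : M) :=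
    fun _ _ => rfl
  have hΦs : ∀ (t : T) (w : T ⊗[R] L), Φ (t • w) = π t • Φ w := by
    intro t w
    induction w with
    | zero => simp
    | tmul t' x => rw [TensorProduct.smul_tmul', hΦ, hΦ, smul_eq_mul, map_mul,
        TensorProduct.smul_tmul', smul_eq_mul]
    | add w w' h h' => rw [smul_add, map_add, map_add, h, h', smul_add]
  -- the elements of `R` that `Φ` kills, once they are lifted to `T ⊗ L`
  let Z : Ideal R :=
    { carrier := {y | ∃ w : T ⊗[R] L,
        L.subtype.lTensor T w = FrobeniusCopy.equiv R p 1 y ⊗ₜ (1 : R) ∧ Φ w = 0}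
      zero_mem' := ⟨0, by simp, map_zero _⟩
      add_mem' := by
        rintro y y' ⟨w, h1, h2⟩ ⟨w', h1', h2'⟩
        exact ⟨w + w', by rw [map_add, h1, h1', map_add, TensorProduct.add_tmul],
          by rw [map_add, h2, h2', add_zero]⟩
      smul_mem' := by
        rintro r y ⟨w, h1, h2⟩
        refine ⟨FrobeniusCopy.equiv R p 1 r • w, ?_, by rw [hΦs, h2, smul_zero]⟩
        have : ∀ (t : T) (w : T ⊗[R] L),
            L.subtype.lTensor T (t • w) = t • L.subtype.lTensor T w := fun t w =>
          (TensorProduct.AlgebraTensorModule.lTensor T T L.subtype).map_smul t w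
        rw [this, h1, TensorProduct.smul_tmul', smul_eq_mul, smul_eq_mul, map_mul] }
  have hlift : ∀ (b : R) (x : L), L.subtype.lTensor T (FrobeniusCopy.equiv R p 1 b ⊗ₜ x) =
      FrobeniusCopy.equiv R p 1 (b * x.1 ^ p) ⊗ₜ (1 : R) := by
    intro b x
    have h1 : (x.1 : R) = x.1 • (1 : R) := by simp
    rw [LinearMap.lTensor_tmul, Submodule.subtype_apply]
    conv_lhs => rw [h1]
    rw [← TensorProduct.smul_tmul, Algebra.smul_def, FrobeniusCopy.algebraMap_apply, ← map_mul,
      mul_comm, pow_one]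
  have hZ : frobeniusPower p 1 J ⊔ I * frobeniusPower p 1 L ≤ Z := by
    refine sup_le (frobeniusPower_le.2 fun a ha => ?_) (Ideal.mul_le.2 fun b hb y hy => ?_)
    · refine ⟨FrobeniusCopy.equiv R p 1 1 ⊗ₜ ⟨a, hJL ha⟩, ?_, ?_⟩
      · rw [hlift, one_mul, pow_one]
      · rw [hΦ, (Submodule.Quotient.mk_eq_zero _).2, TensorProduct.tmul_zero]
        exact ha
    · suffices frobeniusPower p 1 L ≤ Submodule.comap (LinearMap.mulLeft R b) Z from this hy
      refine frobeniusPower_le.2 fun x hx => ⟨FrobeniusCopy.equiv R p 1 b ⊗ₜ ⟨x, hx⟩, ?_, ?_⟩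
      · rw [hlift, LinearMap.mulLeft_apply, pow_one]
      · have : π (FrobeniusCopy.equiv R p 1 b) = 0 := by
          change FrobeniusCopy.equiv (R ⧸ I) p 1 (Ideal.Quotient.mk I b) = 0
          rw [Ideal.Quotient.eq_zero_iff_mem.2 hb, map_zero]
        rw [hΦ, this, TensorProduct.zero_tmul]
  obtain ⟨w, hw1, hw2⟩ := hZ hs
  obtain rfl : w = FrobeniusCopy.equiv R p 1 1 ⊗ₜ ⟨s, hsL⟩ := hL (by
    rw [hw1, hlift, one_mul])
  rw [hΦ, map_one, map_one] at hw2
  have hs0 : (Submodule.Quotient.mk (⟨s, hsL⟩ : L) : M) = 0 :=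
    hpure M (hw2.trans (TensorProduct.tmul_zero _ _).symm)
  exact hsJ ((Submodule.Quotient.mk_eq_zero (J.submoduleOf L)).1 hs0)

variable [IsLocalRing R] [IsNoetherianRing R] {l : List R}

/-- Frobenius powers commute with colons, in one direction and for a finite-colength ideal `J`. -/
theorem mem_frobeniusPower_colon [CharP R p] (hl : Ideal.ofList l = maximalIdeal R)
    (hreg : IsRegular R l) {J L K : Ideal R} {n : ℕ} (hn : maximalIdeal R ^ n ≤ J)
    (hK : ∀ a : R, (∀ y ∈ L, a * y ∈ J) → a ∈ K) {e : ℕ} {x : R}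
    (hx : ∀ y ∈ L, x * y ^ p ^ e ∈ frobeniusPower p e J) : x ∈ frobeniusPower p e K := by
  obtain ⟨k, g, hg⟩ := Submodule.fg_iff_exists_fin_generating_family.1 (IsNoetherian.noetherian L)
  have hgL : ∀ i, g i ∈ L := fun i => hg ▸ Submodule.subset_span ⟨i, rfl⟩
  let z : Fin k → R ⧸ J := fun i => Submodule.Quotient.mk (g i)
  have hfin : IsFiniteLength R (Fin k → R ⧸ J) := by
    obtain ⟨_, _⟩ := isFiniteLength_iff_isNoetherian_isArtinian.1 (isFiniteLength_quotient hn)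
    exact isFiniteLength_iff_isNoetherian_isArtinian.2 ⟨inferInstance, inferInstance⟩
  refine mem_frobeniusPower_of_smul_eq_zero hl hreg hfin (z := z) (fun a ha => hK a ?_) ?_
  · suffices L ≤ Submodule.comap (LinearMap.mulLeft R a) J from fun y hy => this hy
    rw [← hg, Submodule.span_le]
    rintro _ ⟨i, rfl⟩
    exact (Submodule.Quotient.mk_eq_zero J).1 (congrFun ha i)
  · have hz : z = ∑ i, Pi.single i (z i) := (Finset.univ_sum_single z).symm
    rw [smul_frobeniusElement_eq_tmul, hz, TensorProduct.tmul_sum]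
    refine Finset.sum_eq_zero fun i _ => ?_
    have h1 : FrobeniusCopy.equiv R p e x • frobeniusElement R p e (z i) = 0 := by
      have : z i = g i • (Submodule.Quotient.mk 1 : R ⧸ J) := by
        rw [← Submodule.Quotient.mk_smul, smul_eq_mul, mul_one]
      rw [this, frobeniusElement_smul, smul_smul, ← map_mul]
      refine smul_frobeniusElement_eq_zero (J := J) (fun a ha => ?_) (hx _ (hgL i))
      rw [← Submodule.Quotient.mk_smul, smul_eq_mul, mul_one, Submodule.Quotient.mk_eq_zero]
      exact ha
    have := smul_frobeniusElement_map (LinearMap.single R (fun _ : Fin k => R ⧸ J) i) h1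
    rwa [smul_frobeniusElement_eq_tmul] at this

/-- Fedder's criterion modulo a Gorenstein parameter ideal `J`. -/
theorem IsFPure.exists_mul_mem_frobeniusPower_sup [CharP R p]
    (hl : Ideal.ofList l = maximalIdeal R) (hreg : IsRegular R l) {I J : Ideal R} (hI : I ≠ ⊤)
    (hpure : IsFPure p (R ⧸ I)) {n : ℕ} (hn : maximalIdeal R ^ n ≤ J) (hJ : HasSimpleSocle J)
    (hJ' : HasSimpleSocle (frobeniusPower p 1 J)) :
    ∃ r, r ∉ frobeniusPower p 1 (maximalIdeal R) ∧
      ∀ a ∈ I, r * a ∈ frobeniusPower p 1 (J ⊔ I) := by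
  let L : Ideal R := Submodule.colon J (I : Set R)
  have hL : ∀ f, f ∈ L ↔ ∀ a ∈ I, f * a ∈ J := fun f => Submodule.mem_colon
  have hJL : J ≤ L := fun f hf => (hL f).2 fun a _ => Ideal.mul_mem_right a J hf
  obtain ⟨s, hs1, hs2, -⟩ := id hJ
  have hsL : s ∈ L := (hL s).2 fun a ha => mul_comm s a ▸ hs2 a (le_maximalIdeal hI ha)
  have hLT : Function.Injective (L.subtype.lTensor (FrobeniusCopy R p 1)) := by
    refine lTensor_injective_of_isFiniteLength hl (isWeaklyRegular_frobeniusCopy hreg 1) _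
      L.subtype_injective ?_
    rw [Submodule.range_subtype]
    exact isFiniteLength_quotient (hn.trans hJL)
  have hs := hpure.pow_notMem hJL (fun a ha f hf => mul_comm f a ▸ (hL f).1 hf a ha) hLT hsL hs1
  obtain ⟨k, hk⟩ := exists_maximalIdeal_pow_le_frobeniusPower (p := p) 1 hn
  obtain ⟨r, hr1, hr2⟩ := hJ'.exists_mul_notMem hk le_sup_left hs
  refine ⟨r, fun hr => hr2 ?_, fun a ha => ?_⟩
  · suffices frobeniusPower p 1 (maximalIdeal R) ≤
        Submodule.comap (LinearMap.mulRight R (s ^ p)) (frobeniusPower p 1 J) from this hr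
    refine frobeniusPower_le.2 fun a ha => ?_
    have := pow_mem_frobeniusPower (p := p) (e := 1) (hs2 a ha)
    rw [mul_pow, pow_one] at this
    rwa [pow_one]
  · refine mem_frobeniusPower_colon hl hreg hn (L := L) (fun b hb => ?_) fun y hy => ?_
    · by_contra hcon
      obtain ⟨c, hc1, hc2⟩ := hJ.exists_mul_notMem hn (le_sup_left : J ≤ J ⊔ I) hcon
      exact hc2 (mul_comm b c ▸ hb c ((hL c).2 fun a ha => hc1 a (Ideal.mem_sup_right ha)))
    · rw [mul_assoc]
      exact hr1 _ (Ideal.mem_sup_right (Ideal.mul_mem_mul ha (pow_mem_frobeniusPower hy)))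

/-- One direction of Fedder's criterion: if `R ⧸ I` is F-pure, then `I^{[p]} : I` is not contained
in `𝔪^{[p]}`. The approximations modulo `(x₁ ^ t, …, x_d ^ t)` converge by the Artin–Rees lemma. -/
theorem IsFPure.exists_mul_mem_frobeniusPower [CharP R p]
    (hl : Ideal.ofList l = maximalIdeal R) (hreg : IsRegular R l) {I : Ideal R} (hI : I ≠ ⊤)
    (hpure : IsFPure p (R ⧸ I)) :
    ∃ u, u ∉ frobeniusPower p 1 (maximalIdeal R) ∧ ∀ a ∈ I, u * a ∈ frobeniusPower p 1 I := by
  have hp : 0 < p := (Fact.out : p.Prime).pos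
  have approx : ∀ t, ∃ r, r ∉ frobeniusPower p 1 (maximalIdeal R) ∧
      ∀ a ∈ I, r * a ∈ maximalIdeal R ^ t ⊔ frobeniusPower p 1 I := by
    intro t
    let J : Ideal R := Ideal.ofList (l.map (· ^ (t + 1)))
    have hJ : J ≤ maximalIdeal R ^ t := by
      refine Ideal.span_le.2 fun y hy => ?_
      obtain ⟨x, hx, rfl⟩ := List.mem_map.1 hy
      exact Ideal.pow_le_pow_right t.le_succ
        (Ideal.pow_mem_pow (mem_maximalIdeal_of_isRegular hreg x hx) _)
    have hFJ : frobeniusPower p 1 J = Ideal.ofList (l.map (· ^ ((t + 1) * p))) := by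
      rw [frobeniusPower_ofList, List.map_map]
      congr 2
      funext x
      simp [pow_mul]
    obtain ⟨n, hn⟩ : ∃ n, maximalIdeal R ^ n ≤ J := by
      refine Ideal.exists_pow_le_of_le_radical_of_fg ?_ (IsNoetherian.noetherian _)
      rw [← hl]
      exact Ideal.span_le.2 fun x hx =>
        ⟨t + 1, Ideal.subset_span (List.mem_map.2 ⟨x, hx, rfl⟩)⟩
    obtain ⟨r, hr1, hr2⟩ := hpure.exists_mul_mem_frobeniusPower_sup hl hreg hI hn
      (hasSimpleSocle_map_pow hreg hl t.succ_pos)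
      (hFJ ▸ hasSimpleSocle_map_pow hreg hl (Nat.mul_pos t.succ_pos hp))
    refine ⟨r, hr1, fun a ha => ?_⟩
    have := hr2 a ha
    rw [frobeniusPower, Ideal.map_sup] at this
    refine (sup_le_sup_right ?_ _ : _ ≤ maximalIdeal R ^ t ⊔ frobeniusPower p 1 I) this
    exact ((frobeniusPower_le_pow 1 J).trans
      (Ideal.pow_le_self (by rw [pow_one]; exact hp.ne'))).trans hJ
  obtain ⟨k, g, hg⟩ := Submodule.fg_iff_exists_fin_generating_family.1 (IsNoetherian.noetherian I)
  have hgI : ∀ i, g i ∈ I := fun i => hg ▸ Submodule.subset_span ⟨i, rfl⟩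
  let φ : R →ₗ[R] (Fin k → R ⧸ frobeniusPower p 1 I) :=
    LinearMap.toSpanSingleton R _ fun i => Submodule.Quotient.mk (g i)
  have hφ : ∀ r i, φ r i = Submodule.Quotient.mk (r * g i) := fun _ _ => rfl
  obtain ⟨c, hc⟩ := Ideal.exists_pow_inf_eq_pow_smul (maximalIdeal R) (LinearMap.range φ)
  obtain ⟨n, hn⟩ := exists_maximalIdeal_pow_le_frobeniusPower (p := p) 1
    (pow_one (maximalIdeal R)).le
  obtain ⟨r, hr1, hr2⟩ := approx (n + c)
  have hφr : φ r ∈ (maximalIdeal R ^ (n + c) • ⊤ : Submodule R _) ⊓ LinearMap.range φ := by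
    refine ⟨?_, ⟨r, rfl⟩⟩
    rw [← Finset.univ_sum_single (φ r)]
    refine Submodule.sum_mem _ fun i _ => ?_
    obtain ⟨y, hy, y', hy', h⟩ := Submodule.mem_sup.1 (hr2 (g i) (hgI i))
    have : φ r i = y • Submodule.Quotient.mk 1 := by
      rw [hφ, ← h, Submodule.Quotient.mk_add, (Submodule.Quotient.mk_eq_zero _).2 hy', add_zero,
        ← Submodule.Quotient.mk_smul, smul_eq_mul, mul_one]
    rw [this, Pi.single_smul]
    exact Submodule.smul_mem_smul hy trivial
  rw [hc _ (Nat.le_add_left c n), Nat.add_sub_cancel] at hφr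
  have hφr' : φ r ∈ Submodule.map φ (maximalIdeal R ^ n) := by
    have : maximalIdeal R ^ n = maximalIdeal R ^ n • (⊤ : Submodule R R) := by simp
    rw [this, Submodule.map_smul'', Submodule.map_top]
    exact (smul_mono_right _ inf_le_right :
      _ ≤ maximalIdeal R ^ n • LinearMap.range φ) hφr
  obtain ⟨r', hr', h⟩ := hφr'
  refine ⟨r - r', fun hcon => hr1 ?_, ?_⟩
  · have := Ideal.add_mem _ hcon (hn hr')
    rwa [sub_add_cancel] at this
  · suffices Submodule.span R (Set.range g) ≤
        Submodule.comap (LinearMap.mulLeft R (r - r')) (frobeniusPower p 1 I) from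
      fun a ha => this (by rwa [hg])
    rw [Submodule.span_le]
    rintro _ ⟨i, rfl⟩
    have h0 : φ (r - r') i = 0 := by rw [map_sub, h, sub_self]; rfl
    exact (Submodule.Quotient.mk_eq_zero (frobeniusPower p 1 I)).1 h0

end Fedder

/-! ### Regular local rings -/

section RegularLocalRings

open IsLocalRing RingTheory.Sequence

theorem ringKrullDim_le_length {R : Type u} [CommRing R] [IsLocalRing R] [IsNoetherianRing R]
    {l : List R} (hl : Ideal.ofList l = maximalIdeal R) : ringKrullDim R ≤ l.length := by
  classical
  refine (ringKrullDim_le_spanFinrank_maximalIdeal R).trans ?_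
  rw [← hl, Ideal.ofList]
  have h1 : {r | r ∈ l} = (l.toFinset : Set R) := by ext; simp
  have h2 := Submodule.spanFinrank_span_le_ncard_of_finite (R := R) (l.toFinset.finite_toSet)
  rw [Set.ncard_coe_finset] at h2
  rw [h1]
  exact_mod_cast h2.trans l.toFinset_card_le

theorem ofList_map_quotient_mk_eq_maximalIdeal {R : Type u} [CommRing R] [IsLocalRing R]
    {l : List R} {x : R} (hl : Ideal.ofList (x :: l) = maximalIdeal R) {Q : Ideal R} (hx : x ∈ Q)
    [IsLocalRing (R ⧸ Q)] :
    Ideal.ofList (l.map (Ideal.Quotient.mk Q)) = maximalIdeal (R ⧸ Q) := by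
  have hloc := IsLocalHom.of_surjective (Ideal.Quotient.mk Q) Ideal.Quotient.mk_surjective
  rw [← map_maximalIdeal_of_surjective (Ideal.Quotient.mk Q) Ideal.Quotient.mk_surjective, ← hl,
    Ideal.map_ofList, List.map_cons, Ideal.ofList_cons, Ideal.Quotient.eq_zero_iff_mem.2 hx]
  simp

/-- A Noetherian local ring whose maximal ideal is generated by (at most) `dim R` elements is a
domain, and these elements form a regular sequence. -/
theorem isDomain_and_isRegular_of_length_le_ringKrullDim (n : ℕ) :
    ∀ (R : Type u) [CommRing R] [IsLocalRing R] [IsNoetherianRing R] (l : List R), l.length = n →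
      Ideal.ofList l = maximalIdeal R → (n : WithBot ℕ∞) ≤ ringKrullDim R →
      IsDomain R ∧ IsRegular R l := by
  induction n with
  | zero =>
    intro R _ _ _ l hn hl _
    obtain rfl := List.length_eq_zero_iff.1 hn
    rw [Ideal.ofList_nil] at hl
    refine ⟨?_, .nil R R⟩
    have : IsField R := isField_iff_maximalIdeal_eq.2 hl.symm
    exact this.isDomain
  | succ n ih =>
    intro R _ _ _ l hn hl hdim
    obtain ⟨x, l, rfl⟩ := List.exists_cons_of_length_eq_add_one hn
    have hn' : l.length = n := by simpa using hn
    have hxm : x ∈ maximalIdeal R := hl ▸ Ideal.subset_span List.mem_cons_self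
    have hxt : Ideal.span {x} ≠ ⊤ := fun h => hxm (Ideal.span_singleton_eq_top.1 h)
    have : Nontrivial (R ⧸ Ideal.span {x}) := Ideal.Quotient.nontrivial_iff.2 hxt
    have : IsLocalRing (R ⧸ Ideal.span {x}) :=
      .of_surjective' (Ideal.Quotient.mk _) Ideal.Quotient.mk_surjective
    have hl' := ofList_map_quotient_mk_eq_maximalIdeal hl (Ideal.mem_span_singleton_self x)
    have hdimx : (n : WithBot ℕ∞) ≤ ringKrullDim (R ⧸ Ideal.span {x}) := by
      have := ringKrullDim_le_ringKrullDim_quotient_add_card {x} (by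
        rw [Finset.coe_singleton, Set.singleton_subset_iff, ringJacobson_eq_maximalIdeal]
        exact hxm)
      rw [Finset.card_singleton, Finset.coe_singleton] at this
      have h2 := hdim.trans this
      push_cast at h2
      exact (ENat.WithBot.add_le_add_one_right_iff).1 h2
    have hdimx' : ringKrullDim (R ⧸ Ideal.span {x}) ≤ n := by
      simpa [hn'] using ringKrullDim_le_length hl'
    obtain ⟨hdom, hreg⟩ := ih (R ⧸ Ideal.span {x}) _ (by simpa using hn') hl' hdimx
    -- a prime `Q` at the bottom of a chain of primes of length `dim R`
    obtain ⟨c, hc⟩ := Order.le_krullDim_iff.1 (show ((n + 1 : ℕ) : WithBot ℕ∞) ≤ _ from hdim)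
    let Q : Ideal R := c.head.asIdeal
    have hQ : Q.IsPrime := c.head.isPrime
    have hdimQ : ((n + 1 : ℕ) : WithBot ℕ∞) ≤ ringKrullDim (R ⧸ Q) := by
      rw [ringKrullDim_quotient]
      refine Order.le_krullDim_iff.2 ⟨⟨c.length, fun i => ⟨c.toFun i, ?_⟩, fun i => ?_⟩, hc⟩
      · exact c.head_le i
      · exact c.step i
    have hxQ : x ∉ Q := by
      intro hx
      have h1 : ringKrullDim (R ⧸ Q) ≤ ringKrullDim (R ⧸ Ideal.span {x}) :=
        ringKrullDim_le_of_surjective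
          (Ideal.Quotient.factor ((Ideal.span_singleton_le_iff_mem Q).2 hx))
          (Ideal.Quotient.factor_surjective _)
      have h2 := (hdimQ.trans h1).trans hdimx'
      exact absurd (by exact_mod_cast h2 : n + 1 ≤ n) (by omega)
    have hQx : Q ≤ Ideal.span {x} := by
      intro y hy
      by_contra hyx
      have hlocQ : IsLocalRing (R ⧸ Q) :=
        .of_surjective' (Ideal.Quotient.mk _) Ideal.Quotient.mk_surjective
      have hlochom := IsLocalHom.of_surjective (Ideal.Quotient.mk Q) Ideal.Quotient.mk_surjective
      let y' : R ⧸ Ideal.span {x} := Ideal.Quotient.mk _ y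
      let x' : R ⧸ Q := Ideal.Quotient.mk _ x
      let f : R ⧸ Ideal.span {x} →+* (R ⧸ Q) ⧸ Ideal.span {x'} :=
        Ideal.Quotient.lift _ ((Ideal.Quotient.mk _).comp (Ideal.Quotient.mk Q)) (by
          intro a ha
          obtain ⟨b, rfl⟩ := Ideal.mem_span_singleton'.1 ha
          rw [RingHom.comp_apply, Ideal.Quotient.eq_zero_iff_mem, map_mul]
          exact Ideal.mul_mem_left _ _ (Ideal.mem_span_singleton_self _))
      have hf : Function.Surjective f := by
        intro z
        obtain ⟨z, rfl⟩ := Ideal.Quotient.mk_surjective z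
        obtain ⟨z, rfl⟩ := Ideal.Quotient.mk_surjective z
        exact ⟨Ideal.Quotient.mk _ z, rfl⟩
      have hy' : y' ∈ nonZeroDivisors (R ⧸ Ideal.span {x}) :=
        mem_nonZeroDivisors_of_ne_zero fun h => hyx (Ideal.Quotient.eq_zero_iff_mem.1 h)
      have hfy : f y' = 0 := by
        change Ideal.Quotient.mk _ (Ideal.Quotient.mk Q y) = 0
        rw [Ideal.Quotient.eq_zero_iff_mem.2 hy, map_zero]
      have h1 := (ringKrullDim_succ_le_of_surjective f hf hy' hfy).trans hdimx'
      have h2 := ringKrullDim_le_ringKrullDim_quotient_add_card {x'} (by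
        rw [Finset.coe_singleton, Set.singleton_subset_iff, ringJacobson_eq_maximalIdeal]
        exact fun hu => hxm (isUnit_of_map_unit (Ideal.Quotient.mk Q) x hu))
      rw [Finset.card_singleton, Finset.coe_singleton, Nat.cast_one] at h2
      have h3 := (hdimQ.trans h2).trans h1
      exact absurd (by exact_mod_cast h3 : n + 1 ≤ n) (by omega)
    have hQ0 : Q = ⊥ := by
      refine Submodule.eq_bot_of_le_smul_of_le_jacobson_bot (maximalIdeal R) Q
        (IsNoetherian.noetherian Q) (fun y hy => ?_) (maximalIdeal_le_jacobson _)
      obtain ⟨b, rfl⟩ := Ideal.mem_span_singleton'.1 (hQx hy)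
      rw [mul_comm]
      exact Submodule.smul_mem_smul hxm ((hQ.mem_or_mem hy).resolve_right hxQ)
    have hdomR : IsDomain R := by
      rw [hQ0] at hQ
      exact .of_bot_isPrime R
    refine ⟨hdomR, .of_isWeaklyRegular_of_mem_maximalIdeal R
      (fun r hr => hl ▸ Ideal.subset_span hr) (.cons ?_ ?_)⟩
    · refine isSMulRegular_iff_right_eq_zero_of_smul.2 fun a ha => ?_
      refine (mul_eq_zero.1 (show x * a = 0 from ha)).resolve_left fun h => hxQ ?_
      rw [h]
      exact Q.zero_mem
    · have h1 : IsWeaklyRegular (R ⧸ Ideal.span {x}) l :=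
        (isWeaklyRegular_map_algebraMap_iff (R ⧸ Ideal.span {x}) (R ⧸ Ideal.span {x}) l).1 hreg.1
      open scoped Pointwise in
      have h2 : Ideal.span {x} = x • (⊤ : Submodule R R) := by
        rw [← Submodule.ideal_span_singleton_smul, smul_eq_mul, Ideal.mul_top]
      exact ((Submodule.quotEquivOfEq _ _ h2).isWeaklyRegular_congr l).1 h1

theorem exists_isRegular_ofList_eq_maximalIdeal (R : Type u) [CommRing R] [IsRegularLocalRing R] :
    ∃ l : List R, Ideal.ofList l = maximalIdeal R ∧ IsRegular R l ∧
      (l.length : WithBot ℕ∞) = ringKrullDim R := by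
  have hfg := IsNoetherian.noetherian (maximalIdeal R)
  have hfin := Submodule.FG.finite_generators hfg
  let l := hfin.toFinset.toList
  have hl : Ideal.ofList l = maximalIdeal R := by
    rw [Ideal.ofList, ← Submodule.span_generators (maximalIdeal R)]
    simp [l]
  have hlen : (l.length : WithBot ℕ∞) = ringKrullDim R := by
    rw [← IsRegularLocalRing.spanFinrank_maximalIdeal, ← Submodule.FG.generators_ncard hfg,
      Finset.length_toList, Set.ncard_eq_toFinset_card _ hfin]
  exact ⟨l, hl, (isDomain_and_isRegular_of_length_le_ringKrullDim l.length R l rfl hl hlen.le).2,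
    hlen⟩

/-- In a regular local ring of dimension at least two, `𝔪^{[p]} : 𝔪 ⊆ 𝔪 ^ p`. -/
theorem mem_maximalIdeal_pow_of_mul_mem_frobeniusPower {R : Type u} [CommRing R]
    [IsRegularLocalRing R] {p : ℕ} [ExpChar R p] (hp : 2 ≤ p) (hdim : 2 ≤ ringKrullDim R) {f : R}
    (hf : ∀ a ∈ maximalIdeal R, f * a ∈ frobeniusPower p 1 (maximalIdeal R)) :
    f ∈ maximalIdeal R ^ p := by
  obtain ⟨l, hl, hreg, hlen⟩ := exists_isRegular_ofList_eq_maximalIdeal R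
  rw [← hlen] at hdim
  have hlen2 : 2 ≤ l.length := by exact_mod_cast hdim
  obtain ⟨y, z, l, rfl⟩ : ∃ y z l', l = y :: z :: l' := by
    match l, hlen2 with
    | y :: z :: l', _ => exact ⟨y, z, l', rfl⟩
  have hy : y ∈ maximalIdeal R := mem_maximalIdeal_of_isRegular hreg y (by simp)
  have hz : z ∈ maximalIdeal R := mem_maximalIdeal_of_isRegular hreg z (by simp)
  let J : Ideal R := Ideal.ofList ((z :: l).map (· ^ p))
  have hJp : J ≤ maximalIdeal R ^ p := by
    refine Ideal.span_le.2 fun a ha => ?_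
    obtain ⟨b, hb, rfl⟩ := List.mem_map.1 ha
    exact Ideal.pow_mem_pow (mem_maximalIdeal_of_isRegular hreg b (List.mem_cons_of_mem _ hb)) _
  have hF : frobeniusPower p 1 (maximalIdeal R) = Ideal.span {y ^ p} ⊔ J := by
    rw [← hl, frobeniusPower_ofList, pow_one, List.map_cons, Ideal.ofList_cons]
  -- `y` is regular modulo `J`
  have hyJ : ∀ a, y * a ∈ J → a ∈ J := by
    refine ((isRegular_cons_iff_colon hy).1 ?_).2
    refine List.map_pow_induction (n := p) (Q := fun l => IsRegular R (y :: l))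
      (fun _ _ hp h => isRegular_of_perm h (hp.cons y)) (fun x l h => ?_) _ hreg
    exact isRegular_of_perm (isRegular_pow_cons (isRegular_of_perm h (.swap x y l)) (by omega))
      (.swap y _ l)
  have hyJ' : ∀ k a, y ^ k * a ∈ J → a ∈ J := by
    intro k
    induction k with
    | zero => simp
    | succ k ih => exact fun a ha => ih a (hyJ _ (by rwa [← mul_assoc, ← pow_succ']))
  obtain ⟨q, rfl⟩ : ∃ q, p = q + 2 := ⟨p - 2, by omega⟩
  -- `f = a y ^ (p - 1)` modulo `J`
  obtain ⟨a, ha⟩ : ∃ a, f - a * y ^ (q + 1) ∈ J := by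
    have := hf y hy
    rw [hF] at this
    obtain ⟨b, j, hj, hb⟩ := Ideal.mem_span_singleton_sup.1 this
    refine ⟨b, hyJ _ ?_⟩
    convert hj using 1
    linear_combination -hb
  by_cases ham : a ∈ maximalIdeal R
  · have h1 : a * y ^ (q + 1) ∈ maximalIdeal R ^ (q + 2) := by
      rw [pow_succ']
      exact Ideal.mul_mem_mul ham (Ideal.pow_mem_pow hy _)
    have := Ideal.add_mem _ (hJp ha) h1
    rwa [sub_add_cancel] at this
  · -- otherwise `y ^ (p - 1) z ∈ 𝔪^{[p]}`, and `z` is redundant among the generators of `𝔪`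
    exfalso
    have hau : IsUnit a := by_contra fun h => ham h
    have h1 : a * (y ^ (q + 1) * z) ∈ frobeniusPower (q + 2) 1 (maximalIdeal R) := by
      have h2 : (f - a * y ^ (q + 1)) * z ∈ frobeniusPower (q + 2) 1 (maximalIdeal R) := by
        rw [hF]
        exact Ideal.mem_sup_right (Ideal.mul_mem_right _ _ ha)
      have := Ideal.sub_mem _ (hf z hz) h2
      convert this using 1
      ring
    rw [Ideal.unit_mul_mem_iff_mem _ hau, hF] at h1
    obtain ⟨b, j, hj, hb⟩ := Ideal.mem_span_singleton_sup.1 h1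
    have h2 : z - b * y ∈ J := by
      refine hyJ' (q + 1) _ ?_
      convert hj using 1
      linear_combination -hb
    have hz' : IsRegular R (z :: y :: l) := isRegular_of_perm hreg (.swap z y l)
    have hcol := ((isRegular_cons_iff_colon hz).1 hz').2
    have hlJ : J ≤ Ideal.span {z ^ (q + 2)} ⊔ Ideal.ofList (y :: l) := by
      refine Ideal.span_le.2 fun w hw => ?_
      rw [List.map_cons] at hw
      rcases List.mem_cons.1 hw with rfl | hw
      · exact Ideal.mem_sup_left (Ideal.mem_span_singleton_self _)
      · obtain ⟨v, hv, rfl⟩ := List.mem_map.1 hw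
        have hv' : v ∈ Ideal.ofList (y :: l) := Ideal.subset_span (List.mem_cons_of_mem y hv)
        exact Ideal.mem_sup_right (Ideal.pow_mem_of_mem _ hv' _ (by omega))
    obtain ⟨c, w, hw, hc⟩ := Ideal.mem_span_singleton_sup.1 (hlJ h2)
    have hu : (1 - c * z ^ (q + 1)) ∈ Ideal.ofList (y :: l) := by
      refine hcol _ ?_
      have hyl : y ∈ Ideal.ofList (y :: l) := Ideal.subset_span List.mem_cons_self
      have := Ideal.add_mem _ hw (Ideal.mul_mem_left _ b hyl)
      convert this using 1
      linear_combination -hc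
    have hle : Ideal.ofList (y :: l) ≤ maximalIdeal R := Ideal.span_le.2 fun r hr =>
      mem_maximalIdeal_of_isRegular hz' r (List.mem_cons_of_mem _ hr)
    have := Ideal.add_mem _ (hle hu)
      (Ideal.mul_mem_left _ c (Ideal.pow_mem_of_mem _ hz (q + 1) (by omega)))
    rw [sub_add_cancel] at this
    exact (Ideal.ne_top_iff_one _).1 (maximalIdeal.isMaximal R).ne_top this

end RegularLocalRings

/-! ### Symbolic powers of ideals with F-pure quotient -/

section SymbolicPowers

open IsLocalRing

theorem charP_of_algebra (R : Type u) {S : Type u} [CommRing R] [CommRing S] [Algebra R S]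
    [Nontrivial S] (p : ℕ) [Fact p.Prime] [CharP R p] : CharP S p := by
  refine (CharP.charP_iff_prime_eq_zero (Fact.out : p.Prime)).2 ?_
  rw [← map_natCast (algebraMap R S), CharP.cast_eq_zero, map_zero]

theorem frobeniusPower_map {R S : Type u} [CommRing R] [CommRing S] {p : ℕ} [ExpChar R p]
    [ExpChar S p] (f : R →+* S) (e : ℕ) (J : Ideal R) :
    frobeniusPower p e (J.map f) = (frobeniusPower p e J).map f := by
  rw [frobeniusPower, frobeniusPower, Ideal.map_map, Ideal.map_map]
  congr 1
  ext x
  simp [iterateFrobenius_def]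

theorem IsFPure.isReduced {R : Type u} [CommRing R] {p : ℕ} [Fact p.Prime] (h : IsFPure p R) :
    IsReduced R := by
  obtain ⟨_, h⟩ := h
  refine (isReduced_iff_pow_one_lt p (Fact.out : p.Prime).one_lt).2 fun x hx => h R ?_
  have hx1 : x = x • (1 : R) := by simp
  change (1 : FrobeniusCopy R p 1) ⊗ₜ[R] x = (1 : FrobeniusCopy R p 1) ⊗ₜ[R] (0 : R)
  conv_lhs => rw [hx1]
  rw [← TensorProduct.smul_tmul, Algebra.smul_def, FrobeniusCopy.algebraMap_apply, pow_one, hx,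
    map_zero, zero_mul, TensorProduct.zero_tmul, TensorProduct.tmul_zero]

theorem mem_symbolicPower {R : Type u} [CommRing R] {I : Ideal R} {m : ℕ} {x : R} :
    x ∈ symbolicPower I m ↔ ∃ w ∈ associatedPrimesCompl I, w * x ∈ I ^ m := by
  rw [symbolicPower, Ideal.mem_comap,
    IsLocalization.algebraMap_mem_map_algebraMap_iff (associatedPrimesCompl I)]

theorem pow_mem_symbolicPower {R : Type u} [CommRing R] {I : Ideal R} {m : ℕ} {x : R}
    (hx : x ∈ symbolicPower I m) (k : ℕ) : x ^ k ∈ symbolicPower I (m * k) := by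
  obtain ⟨w, hw, h⟩ := mem_symbolicPower.1 hx
  refine mem_symbolicPower.2 ⟨w ^ k, Submonoid.pow_mem _ hw k, ?_⟩
  rw [← mul_pow, pow_mul]
  exact Ideal.pow_mem_pow h k

/-- Membership in a symbolic power can be tested after localizing at the associated primes. -/
theorem mem_symbolicPower_of_forall_associatedPrimes {R : Type u} [CommRing R] [IsNoetherianRing R]
    {I : Ideal R} {m : ℕ} {x : R}
    (h : ∀ P ∈ associatedPrimes R (R ⧸ I), ∃ w ∉ P, w * x ∈ I ^ m) : x ∈ symbolicPower I m := by
  rw [mem_symbolicPower]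
  by_contra! hcon
  let K : Ideal R := Submodule.comap (LinearMap.mulRight R x) (I ^ m)
  obtain ⟨P, hP, hKP⟩ := (Ideal.subset_union_prime_finite
    (associatedPrimes.finite R (R ⧸ I)) (f := id) ⊥ ⊥ (fun P hP _ _ => hP.1) (I := K)).1 (by
      intro w hw
      have : ¬ w ∈ associatedPrimesCompl I := fun hw' => hcon w hw' hw
      simp only [Set.mem_iUnion]
      by_contra! hw'
      exact this fun P hP hwP => hw' P hP hwP)
  obtain ⟨w, hw, hwx⟩ := h P hP
  exact hw (hKP hwx)

/-- A radical ideal agrees with each of its associated primes `P` after localization at `P`. -/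
theorem map_localization_eq_maximalIdeal {R : Type u} [CommRing R] [IsNoetherianRing R]
    {I : Ideal R} (hI : I.IsRadical) {P : Ideal R} (hP : P ∈ associatedPrimes R (R ⧸ I))
    [P.IsPrime] :
    I ≤ P ∧ I.map (algebraMap R (Localization.AtPrime P)) =
      maximalIdeal (Localization.AtPrime P) := by
  obtain ⟨-, x, hx⟩ := isAssociatedPrime_iff.1 hP
  obtain ⟨x, rfl⟩ := Submodule.Quotient.mk_surjective _ x
  have hmem : ∀ a, a ∈ P ↔ a * x ∈ I := fun a => by
    rw [hx, Submodule.mem_colon_singleton, ← Submodule.Quotient.mk_smul, Submodule.mem_bot,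
      Submodule.Quotient.mk_eq_zero, smul_eq_mul]
  have hxP : x ∉ P := fun h => by
    have h1 : x ∈ I := hI ⟨2, by rw [pow_two]; exact (hmem x).1 h⟩
    exact (Ideal.ne_top_iff_one P).1 (Ideal.IsPrime.ne_top inferInstance)
      ((hmem 1).2 (by rwa [one_mul]))
  have hIP : I ≤ P := fun a ha => (hmem a).2 (I.mul_mem_right x ha)
  refine ⟨hIP, ?_⟩
  rw [← Localization.AtPrime.map_eq_maximalIdeal]
  refine le_antisymm (Ideal.map_mono hIP) (Ideal.map_le_iff_le_comap.2 fun a ha => ?_)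
  rw [Ideal.mem_comap, IsLocalization.algebraMap_mem_map_algebraMap_iff P.primeCompl]
  exact ⟨x, hxP, by rw [mul_comm]; exact (hmem a).1 ha⟩

/-- If every localization of `R` is regular and `I` is a radical ideal of height at least two, then
`I^{[p]} : I ⊆ I^{(p)}`. -/
theorem mem_symbolicPower_of_mul_mem_frobeniusPower {R : Type u} [CommRing R] [IsRegularRing R]
    {p : ℕ} [Fact p.Prime] [CharP R p] {I : Ideal R} (hI : I.IsRadical) (hht : 2 ≤ I.height) {u : R}
    (hu : ∀ a ∈ I, u * a ∈ frobeniusPower p 1 I) : u ∈ symbolicPower I p := by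
  refine mem_symbolicPower_of_forall_associatedPrimes fun P hP => ?_
  have := hP.1
  obtain ⟨hIP, hmap⟩ := map_localization_eq_maximalIdeal hI hP
  have hreg : IsRegularLocalRing (Localization.AtPrime P) := isRegularRing_iff.1 ‹_› P
  have : CharP (Localization.AtPrime P) p := charP_of_algebra R p
  have hdim : 2 ≤ ringKrullDim (Localization.AtPrime P) := by
    rw [IsLocalization.AtPrime.ringKrullDim_eq_height P]
    exact WithBot.coe_le_coe.2 (hht.trans (Ideal.height_mono hIP))
  have key := mem_maximalIdeal_pow_of_mul_mem_frobeniusPower (p := p)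
    (Fact.out : p.Prime).two_le hdim (f := algebraMap R (Localization.AtPrime P) u) (by
      rw [← hmap, frobeniusPower_map]
      suffices I.map (algebraMap R (Localization.AtPrime P)) ≤ Submodule.comap
          (LinearMap.mulLeft _ (algebraMap R (Localization.AtPrime P) u))
          ((frobeniusPower p 1 I).map (algebraMap R (Localization.AtPrime P))) from
        fun a ha => this ha
      refine Ideal.map_le_iff_le_comap.2 fun a ha => ?_
      rw [Ideal.mem_comap, Submodule.mem_comap, LinearMap.mulLeft_apply, ← map_mul]
      exact Ideal.mem_map_of_mem _ (hu a ha))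
  rw [← hmap, ← Ideal.map_pow,
    IsLocalization.algebraMap_mem_map_algebraMap_iff P.primeCompl] at key
  obtain ⟨w, hw, h⟩ := key
  exact ⟨w, hw, h⟩

/-- The regular locus of an excellent regular local ring is open and contains the closed point, so
that it is the whole spectrum. -/
theorem IsExcellentRing.isRegularRing {R : Type u} [CommRing R] [IsRegularLocalRing R]
    (hR : IsExcellentRing R) : IsRegularRing R := by
  refine isRegularRing_iff.2 fun P hP => ?_
  let U : TopologicalSpace.Opens (PrimeSpectrum R) := ⟨_, hR.j_two R⟩
  have hU : closedPoint R ∈ U := by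
    change IsRegularLocalRing (Localization.AtPrime (maximalIdeal R))
    refine IsRegularLocalRing.of_ringEquiv (R := R) (IsLocalization.atUnits R
      (maximalIdeal R).primeCompl (S := Localization.AtPrime (maximalIdeal R)) ?_).toRingEquiv
    exact fun x hx => by_contra fun h => hx h
  rw [closedPoint_mem_iff] at hU
  have : (⟨P, hP⟩ : PrimeSpectrum R) ∈ U := hU ▸ trivial
  exact this

end SymbolicPowers

/-! ### Completions -/

section Completion

open IsLocalRing RingTheory.Sequence

/-- In a ring that is complete for a finitely generated ideal `J`, let `P` be a prime ideal and
`x ∈ J`, `x ∉ P`. Generators of `P` modulo `x` that lie in `P` generate `P`: division by `x` does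
not leave `P`, and the resulting power series in `x` converge. -/
theorem fg_of_sup_span_fg {S : Type u} [CommRing S] (J : Ideal S) [IsAdicComplete J S]
    {P : Ideal S} [hP : P.IsPrime] {x : S} (hxJ : x ∈ J) (hxP : x ∉ P)
    (hfg : (P ⊔ Ideal.span {x}).FG) : P.FG := by
  obtain ⟨k, g, hg⟩ := Submodule.fg_iff_exists_fin_generating_family.1 hfg
  have hgm : ∀ i, g i ∈ P ⊔ Ideal.span {x} := fun i => hg ▸ Submodule.subset_span ⟨i, rfl⟩
  have hdec : ∀ i, ∃ f ∈ P, ∃ b, f + b * x = g i := fun i => by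
    obtain ⟨f, hf, y, hy, h⟩ := Submodule.mem_sup.1 (hgm i)
    obtain ⟨b, rfl⟩ := Ideal.mem_span_singleton'.1 hy
    exact ⟨f, hf, b, h⟩
  choose f hfP b hfb using hdec
  have hstep : ∀ y : P, ∃ (c : Fin k → S) (z : P), y.1 = ∑ i, c i * f i + x * z.1 := by
    intro y
    have hy : y.1 ∈ Submodule.span S (Set.range g) := by
      rw [hg]
      exact Ideal.mem_sup_left y.2
    obtain ⟨c, hc⟩ := Submodule.mem_span_range_iff_exists_fun S |>.1 hy
    have h1 : y.1 = ∑ i, c i * f i + x * ∑ i, c i * b i := by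
      rw [← hc, Finset.mul_sum, ← Finset.sum_add_distrib]
      refine Finset.sum_congr rfl fun i _ => ?_
      rw [← hfb, smul_eq_mul]
      ring
    have h2 : x * ∑ i, c i * b i ∈ P := by
      have : x * ∑ i, c i * b i = y.1 - ∑ i, c i * f i := by rw [h1]; ring
      rw [this]
      exact P.sub_mem y.2 (P.sum_mem fun i _ => P.mul_mem_left _ (hfP i))
    exact ⟨c, ⟨_, (hP.mem_or_mem h2).resolve_left hxP⟩, h1⟩
  choose c next hnext using hstep
  refine Submodule.fg_iff_exists_fin_generating_family.2 ⟨k, f, le_antisymm ?_ fun y hy => ?_⟩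
  · rw [Submodule.span_le]
    rintro _ ⟨i, rfl⟩
    exact hfP i
  · let s : ℕ → P := fun n => next^[n] ⟨y, hy⟩
    let C : Fin k → ℕ → S := fun i N => ∑ n ∈ Finset.range N, x ^ n * c (s n) i
    have hC : ∀ N, y = ∑ i, C i N * f i + x ^ N * (s N).1 := by
      intro N
      induction N with
      | zero => simp [C, s]
      | succ N ih =>
        have h1 : (s N).1 = ∑ i, c (s N) i * f i + x * (s (N + 1)).1 := by
          simp only [s, Function.iterate_succ_apply']
          exact hnext _
        rw [ih, h1, mul_add, ← add_assoc, Finset.mul_sum, ← Finset.sum_add_distrib]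
        congr 1
        · refine Finset.sum_congr rfl fun i _ => ?_
          simp only [C, Finset.sum_range_succ]
          ring
        · ring
    have hlim : ∀ i, ∃ L : S, ∀ n, C i n - L ∈ J ^ n := by
      intro i
      obtain ⟨L, hL⟩ := IsPrecomplete.prec' (I := J) (C i) (fun {m n} hmn => by
        rw [SModEq.sub_mem, smul_eq_mul, Ideal.mul_top, ← neg_sub, neg_mem_iff]
        simp only [C, ← Finset.sum_range_add_sum_Ico _ hmn, add_sub_cancel_left]
        exact Ideal.sum_mem _ fun j hj => Ideal.mul_mem_right _ _
          (Ideal.pow_le_pow_right (Finset.mem_Ico.1 hj).1 (Ideal.pow_mem_pow hxJ j)))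
      refine ⟨L, fun n => ?_⟩
      simpa [SModEq.sub_mem] using hL n
    choose L hL using hlim
    have hy : y - ∑ i, L i * f i = 0 := by
      refine IsHausdorff.haus' (I := J) _ fun n => ?_
      rw [SModEq.sub_mem, sub_zero, smul_eq_mul, Ideal.mul_top]
      have : y - ∑ i, L i * f i = ∑ i, (C i n - L i) * f i + x ^ n * (s n).1 := by
        simp only [sub_mul, Finset.sum_sub_distrib]
        linear_combination hC n
      rw [this]
      exact Ideal.add_mem _ (Ideal.sum_mem _ fun i _ => Ideal.mul_mem_right _ _ (hL i n))
        (Ideal.mul_mem_right _ _ (Ideal.pow_mem_pow hxJ n))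
    rw [sub_eq_zero.1 hy]
    exact Submodule.sum_mem _ fun i _ =>
      Submodule.smul_mem _ _ (Submodule.subset_span ⟨i, rfl⟩)

/-- A ring that is complete for a finitely generated ideal `J` with Noetherian quotient is
Noetherian. By Cohen's theorem only prime ideals matter, and the generators of `J` are removed one
at a time. -/
theorem isNoetherianRing_of_isAdicComplete {S : Type u} [CommRing S] {J : Ideal S} (hJ : J.FG)
    [IsAdicComplete J S] [IsNoetherianRing (S ⧸ J)] : IsNoetherianRing S := by
  have lift : ∀ A : Ideal S, A.FG → IsNoetherianRing (S ⧸ A) → ∀ K, A ≤ K → K.FG := by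
    intro A hA hSA K hAK
    refine Ideal.fg_of_fg_map_of_fg_inf_ker_of_surjective (f := Ideal.Quotient.mk A)
      (IsNoetherian.noetherian _) ?_ Ideal.Quotient.mk_surjective
    rwa [Ideal.mk_ker, inf_eq_right.2 hAK]
  have hlist : ∀ l : List S, (Ideal.ofList l).FG := fun l => by
    classical
    exact ⟨l.toFinset, by simp [Ideal.ofList, Ideal.span]⟩
  suffices H : ∀ l₂ l₁ : List S, Ideal.ofList (l₁ ++ l₂) = J →
      ∀ K, Ideal.ofList l₁ ≤ K → K.FG by
    obtain ⟨t, ht⟩ := hJ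
    exact ⟨fun K => H t.toList [] (by simpa [Ideal.ofList, Ideal.span] using ht) K (by simp)⟩
  intro l₂
  induction l₂ with
  | nil =>
    intro l₁ h
    rw [List.append_nil] at h
    exact h ▸ lift J hJ ‹_›
  | cons x l₂ ih =>
    intro l₁ h
    have ih' := ih (l₁ ++ [x]) (by simpa using h)
    refine lift _ (hlist l₁) (IsNoetherianRing.of_prime fun P' hP' => ?_)
    let P : Ideal S := P'.comap (Ideal.Quotient.mk _)
    have hP : P.IsPrime := Ideal.comap_isPrime _ _
    have hlP : Ideal.ofList l₁ ≤ P := fun a ha => by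
      rw [Ideal.mem_comap, Ideal.Quotient.eq_zero_iff_mem.2 ha]
      exact P'.zero_mem
    have hxJ : x ∈ J := h ▸ Ideal.subset_span (by simp)
    suffices hfg : P.FG by
      rw [← Ideal.map_comap_of_surjective _ Ideal.Quotient.mk_surjective P']
      exact hfg.map _
    by_cases hxP : x ∈ P
    · refine ih' P ?_
      rw [Ideal.ofList_append, Ideal.ofList_singleton]
      exact sup_le hlP ((Ideal.span_singleton_le_iff_mem P).2 hxP)
    · refine fg_of_sup_span_fg J hxJ hxP (ih' _ ?_)
      rw [Ideal.ofList_append, Ideal.ofList_singleton]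
      exact sup_le_sup_right hlP _

variable (R : Type u) [CommRing R] [IsLocalRing R] [IsNoetherianRing R]

theorem isNoetherianRing_adicCompletion :
    IsNoetherianRing (AdicCompletion (maximalIdeal R) R) := by
  have hfg : (maximalIdeal (AdicCompletion (maximalIdeal R) R)).FG := by
    rw [AdicCompletion.maximalIdeal_eq_map]
    exact Ideal.FG.map (IsNoetherian.noetherian _) _
  have : IsNoetherianRing (AdicCompletion (maximalIdeal R) R ⧸
      maximalIdeal (AdicCompletion (maximalIdeal R) R)) :=
    inferInstanceAs (IsNoetherianRing (ResidueField (AdicCompletion (maximalIdeal R) R)))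
  exact isNoetherianRing_of_isAdicComplete hfg

theorem faithfullyFlat_adicCompletion :
    Module.FaithfullyFlat R (AdicCompletion (maximalIdeal R) R) :=
  .of_flat_of_isLocalHom

end Completion

theorem lemma3p2 {R : Type u} [CommRing R] [IsRegularLocalRing R] (hR : IsExcellentRing R)
    (p : ℕ) [Fact p.Prime] [CharP R p]
    (I : Ideal R) (hI : I ≠ ⊤) (hht : 2 ≤ I.height) (hpure : IsFPure p (R ⧸ I)) :
    generalizedTestIdeal p
        (fun m => (symbolicPower I m).map
          (algebraMap R (AdicCompletion (IsLocalRing.maximalIdeal R) R))) 1 = ⊤ ∧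
      (IsFFinite p R → generalizedTestIdeal p (symbolicPower I) 1 = ⊤) := by
  obtain ⟨l, hl, hreg, -⟩ := exists_isRegular_ofList_eq_maximalIdeal R
  have := hR.isRegularRing
  obtain ⟨u, hu, huI⟩ := hpure.exists_mul_mem_frobeniusPower hl hreg hI
  have hrad : I.IsRadical := (Ideal.isRadical_iff_quotient_reduced I).2 hpure.isReduced
  have hsym : ∀ e, u ^ p ^ e ∈ symbolicPower I (p ^ (e + 1)) := fun e => by
    rw [pow_succ']
    exact pow_mem_symbolicPower (mem_symbolicPower_of_mul_mem_frobeniusPower hrad hht huI) _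
  refine ⟨?_, fun _ => generalizedTestIdeal_eq_top p hl hreg hu hsym⟩
  let S := AdicCompletion (IsLocalRing.maximalIdeal R) R
  have := isNoetherianRing_adicCompletion R
  have := faithfullyFlat_adicCompletion R
  have hlS : Ideal.ofList (l.map (algebraMap R S)) = IsLocalRing.maximalIdeal S := by
    rw [← Ideal.map_ofList, hl, AdicCompletion.maximalIdeal_eq_map]
  refine generalizedTestIdeal_eq_top p hlS hreg.of_faithfullyFlat (u := algebraMap R S u) ?_ ?_
  · rwa [AdicCompletion.maximalIdeal_eq_map, frobeniusPower_map, ← Ideal.mem_comap,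
      Ideal.comap_map_eq_self_of_faithfullyFlat]
  · intro e
    rw [← map_pow]
    exact Ideal.mem_map_of_mem _ (hsym e)
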